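/- \textbf{Setting.} Let $n=8m+1$ and $N=(n-1)/4$. Let $r_j=-\cos\!\big(\pi\frac{2j-1}{2n}\big)$, $1\le j\le n$, be the roots of the Chebyshev polynomial $T_n$ in increasing order, $|I_j|=r_{j+1}-r_j$, and for $1\le k\le N$ let $G_k=[r_{4k-3},r_{4k+1}]$, a block with interior roots $r_{4k-2},r_{4k-1},r_{4k}$ and ratio $a_k=|I_{4k-2}|/|I_{4k-1}|$. For real $\varepsilon$ and $a>0$ with $(a-\varepsilon)^2\ge 4\varepsilon(1+\varepsilon)$ let $$\delta(\varepsilon,a)=\tfrac12\Big(a-\varepsilon-\sqrt{(a-\varepsilon)^2-4\varepsilon(1+\varepsilon)}\Big),$$ i.e. the solution of $a\delta-\varepsilon-\delta\varepsilon-\delta^2-\varepsilon^2=0$ with $\delta=\varepsilon/a+O(\varepsilon^2)$. For $y\in\mathbb R^N$ let $T_n(x,y)$ be the polynomial in $x$ with leading coefficient $2^{n-1}$ obtained from $T_n$ by keeping the roots $r_{4k-3}$ ($1\le k\le N+1$) and replacing, in every block $G_k$, $$r_{4k-2}\to r_{4k-2}+\delta(y_k,a_k)|I_{4k-1}|,\quad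 r_{4k-1}\to r_{4k-1}-\big(y_k+\delta(y_k,a_k)\big)|I_{4k-1}|,\quad r_{4k}\to r_{4k}+y_k|I_{4k-1}|.$$ Let $A_k(y)=\frac1{|G_k|}\int_{G_k}T_n(x,y)\,dx$, let $\widetilde y_k\in\mathbb R^N$ have $k$-th coordinate $y_k$ and all other coordinates $0$, and let $Q^N_t=[-t,t]^N$. For $K\in\mathbb N$ define $f,g:Q^N_t\to\mathbb R^N$ by $f_k(y)=A_k(\widetilde y_k)$ and $g_k(y)=A_k(y)$ if $K<k\le N-K$, and $f_k(y)=g_k(y)=y_k$ for all other $k$. \textbf{Theorem.} There are $t>0$ and $n_0,K_0\in\mathbb N$ such that for all $K\ge K_0$ and all $n\ge n_0$ with $n\in 8\mathbb N+1$ the following hold: $(a_k-s)^2\ge 4s(1+s)$ for all $1\le k\le N$ and $|s|\le t$ (so that $T_n(x,y)$ is defined for all $y\in Q^N_t$); $$Q^N_t\subset f(Q^N_t);$$ and, for every $1\le k\le N$, $\ \sup_{y\in Q^N_t}|f_k(y)-g_k(y)|\le t/2$. -/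

import Mathlib

namespace ChebPerturb

noncomputable section

/-- The `j`-th root (`1 ≤ j ≤ n`) of the Chebyshev polynomial `T_n`, numbered from left to right. -/
def root (n j : ℕ) : ℝ := -Real.cos (Real.pi * (2 * (j : ℝ) - 1) / (2 * (n : ℝ)))

/-- The length of the nodal interval `I^n_j = [root n j, root n (j + 1)]`, `1 ≤ j ≤ n - 1`. -/
def nodalLength (n j : ℕ) : ℝ := root n (j + 1) - root n j

/-- The number `N` of blocks of four consecutive nodal intervals. -/
abbrev numBlocks (n : ℕ) : ℕ := (n - 1) / 4

/-! A block is indexed by `i : Fin (numBlocks n)`, and `i` stands for the block number `k = i + 1`.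
So the block is `[root n (4k-3), root n (4k+1)] = [root n (4i+1), root n (4i+5)]`, and its left,
center and right interior roots are `root n (4i+2)`, `root n (4i+3)` and `root n (4i+4)`. -/

/-- The ratio `a` of the lengths of the two middle nodal intervals of a block. -/
def blockRatio (n : ℕ) (i : Fin (numBlocks n)) : ℝ :=
  nodalLength n (4 * (i : ℕ) + 2) / nodalLength n (4 * (i : ℕ) + 3)

/-- The discriminant of the quadratic equation `δ ^ 2 - (a - ε) δ + ε (1 + ε) = 0`. -/
def deltaDisc (ε a : ℝ) : ℝ := (a - ε) ^ 2 - 4 * (ε * (1 + ε))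

/-- The displacement `δ(ε, a)`: the solution of `a δ - ε - δ ε - δ ^ 2 - ε ^ 2 = 0` on the branch
with `δ(0, a) = 0` (so `δ = ε / a + O(ε ^ 2)`). It is meaningful when `0 ≤ deltaDisc ε a`. -/
def delta (ε a : ℝ) : ℝ := ((a - ε) - Real.sqrt (deltaDisc ε a)) / 2

theorem delta_equation {ε a : ℝ} (h : 0 ≤ deltaDisc ε a) :
    a * delta ε a - ε - delta ε a * ε - delta ε a ^ 2 - ε ^ 2 = 0 := by
  have hs := Real.sq_sqrt h
  unfold delta
  generalize Real.sqrt (deltaDisc ε a) = s at hs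
  unfold deltaDisc at hs
  linear_combination (-1 / 4 : ℝ) * hs

theorem delta_zero {a : ℝ} (ha : 0 ≤ a) : delta 0 a = 0 := by
  simp [delta, deltaDisc, Real.sqrt_sq ha]

/-- With `δ = delta ε a` the three-point distortion factor moving the roots `-a, 0, 1` to
`-a + δ, -δ - ε, 1 + ε` differs from `1` by a constant over the cubic (this is what `δ` is for). -/
theorem delta_cubic {ε a : ℝ} (h : 0 ≤ deltaDisc ε a) (x : ℝ) :
    (x + a - delta ε a) * (x + delta ε a + ε) * (x - 1 - ε) =
      (x + a) * x * (x - 1) + (a - delta ε a) * (delta ε a + ε) * (-1 - ε) := by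
  linear_combination x * delta_equation h

/-- The left interior root of a block, perturbed by a factor `s`. -/
def leftRoot (n : ℕ) (i : Fin (numBlocks n)) (s : ℝ) : ℝ :=
  root n (4 * (i : ℕ) + 2) + delta s (blockRatio n i) * nodalLength n (4 * (i : ℕ) + 3)

/-- The center interior root of a block, perturbed by a factor `s`. -/
def centerRoot (n : ℕ) (i : Fin (numBlocks n)) (s : ℝ) : ℝ :=
  root n (4 * (i : ℕ) + 3) - (s + delta s (blockRatio n i)) * nodalLength n (4 * (i : ℕ) + 3)

/-- The right interior root of a block, perturbed by a factor `s`. -/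
def rightRoot (n : ℕ) (i : Fin (numBlocks n)) (s : ℝ) : ℝ :=
  root n (4 * (i : ℕ) + 4) + s * nodalLength n (4 * (i : ℕ) + 3)

/-- The perturbed Chebyshev polynomial `x ↦ T_n(x, y)` (for `n ≡ 1 mod 4`): the interior roots of
each block are perturbed by the factor `y i`, and the `N + 1` endpoints of blocks are kept. -/
def perturbedT (n : ℕ) (y : Fin (numBlocks n) → ℝ) (x : ℝ) : ℝ :=
  2 ^ (n - 1) * (∏ j ∈ Finset.range (numBlocks n + 1), (x - root n (4 * j + 1))) *
    ∏ i : Fin (numBlocks n),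
      ((x - leftRoot n i (y i)) * (x - centerRoot n i (y i)) * (x - rightRoot n i (y i)))

/-- The average of `T_n(·, y)` over the block `i`. -/
def blockAverage (n : ℕ) (i : Fin (numBlocks n)) (y : Fin (numBlocks n) → ℝ) : ℝ :=
  (1 / (root n (4 * (i : ℕ) + 5) - root n (4 * (i : ℕ) + 1))) *
    ∫ x in (root n (4 * (i : ℕ) + 1))..(root n (4 * (i : ℕ) + 5)), perturbedT n y x

/-- The block number `k = i + 1` satisfies `K < k ≤ N - K`. -/
def IsCentral (n K : ℕ) (i : Fin (numBlocks n)) : Prop :=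
  K < (i : ℕ) + 1 ∧ (i : ℕ) + 1 + K ≤ numBlocks n

open Classical in
/-- The decoupled map `f`: on a central block, average the polynomial perturbed in that block
only; the other coordinates are left unchanged. -/
def decoupled (n K : ℕ) (y : Fin (numBlocks n) → ℝ) : Fin (numBlocks n) → ℝ := fun i =>
  if IsCentral n K i then blockAverage n i (Pi.single i (y i)) else y i

open Classical in
/-- The coupled map `g`: on a central block, average the polynomial perturbed in all blocks
simultaneously; the other coordinates are left unchanged. -/
def coupled (n K : ℕ) (y : Fin (numBlocks n) → ℝ) : Fin (numBlocks n) → ℝ := fun i =>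
  if IsCentral n K i then blockAverage n i y else y i

/-- The cube `Q^N_t = [-t, t]^N`. -/
def cube (N : ℕ) (t : ℝ) : Set (Fin N → ℝ) := {y | ∀ i, y i ∈ Set.Icc (-t) t}

end

end ChebPerturb

/-! Put `x = -cos (π u / n)`. In the index `u` the roots become the points `j - 1/2`, `T_n` becomes
`-cos (π u)`, and block `k` is the set of `u = 4k + 5/2 + w` with `|w| ≤ 2`, whose interior roots
are `w = -1, 0, 1`. A difference of two points is a product of two sines, so away from the ends of
`[-1, 1]` the roots are equally spaced locally, up to relative errors `O(1/K)`.

The displacement `δ` is chosen so that perturbing a block by `s` only subtracts a constant, `shift s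
a * L ^ 3`, from the cubic of its interior roots (`perturbed_block`). Here `L` is the length of the
right middle interval and `shift s a` is about `s * (1 + a)`.

Covering: the decoupled average is therefore `offset + shift * gain`. On a central block the average
of `T_n` is `O(1/K)` (`abs_offset_le`), since `cos (π u)` has mean zero over a block and the density
varies little. Also `(1 + a) * gain ≥ 13/10` (`le_gain`): the sensitivity is nonnegative on the
block and close to `sin (π w) / (w (1 - w ^ 2)) ≥ 3/2` on its middle half. A slope above `1` beats
the small offset, and the intermediate value theorem in each coordinate gives the inclusion.

Coupling: at a point of block `k`, the other blocks multiply the polynomial by a product of factors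
`1 - shift * L ^ 3 / cubic`. A block whose center is at index distance `D` contributes about `2 t /
(D (D ^ 2 - 1))` (`block_effect`). The distances are at least `2, 4, 6, ...`, each value serving at
most one block, so the total is about `t * ∑ 1 / (e (4 e ^ 2 - 1)) = (2 log 2 - 1) t < 2 t / 5`. As
the polynomial itself is at most about `1` in size, the difference is below `t / 2` even pointwise,
before averaging. -/

namespace ChebPerturb

open Real MeasureTheory

/-! ### Index coordinates and distances between roots -/

/-- The point of `[-1, 1]` with index `u`; the `j`-th Chebyshev root has index `j - 1/2`. -/
noncomputable def pt (n : ℕ) (u : ℝ) : ℝ := -cos (π * u / n)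

/-- The nodal length as a function of a real index. -/
noncomputable def len (n : ℕ) (m : ℝ) : ℝ := 2 * sin (π * m / n) * sin (π / (2 * n))

theorem root_eq_pt (n j : ℕ) : root n j = pt n (j - 1 / 2) := by
  unfold root pt
  congr 2
  rcases eq_or_ne (n : ℝ) 0 with h | h
  · simp [h]
  · field_simp

theorem pt_sub_pt (n : ℕ) (u v : ℝ) :
    pt n u - pt n v = 2 * sin (π * ((u + v) / 2) / n) * sin (π * ((u - v) / 2) / n) := by
  have h := cos_sub_cos (π * v / n) (π * u / n)
  have e1 : (π * v / n + π * u / n) / 2 = π * ((u + v) / 2) / n := by ring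
  have e2 : (π * v / n - π * u / n) / 2 = -(π * ((u - v) / 2) / n) := by ring
  rw [e1, e2, sin_neg] at h
  unfold pt
  linarith

theorem nodalLength_eq_len (n j : ℕ) : nodalLength n j = len n j := by
  unfold nodalLength len
  rw [root_eq_pt, root_eq_pt, pt_sub_pt]
  push_cast
  have e1 : ((j : ℝ) + 1 - 1 / 2 + (j - 1 / 2)) / 2 = j := by ring
  have e2 : π * (((j : ℝ) + 1 - 1 / 2 - (j - 1 / 2)) / 2) / n = π / (2 * n) := by ring
  rw [e1, e2]

/-- Jordan's inequality after reflecting to the nearer end: an index at distance `M` from both ends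
gives a sine of order at least `M / n`. -/
theorem sin_ge_of_index {n : ℕ} {M s : ℝ} (hM : 0 ≤ M) (h1 : M ≤ s) (h2 : M ≤ n - s) :
    2 * M / n ≤ sin (π * s / n) := by
  have hn : (0 : ℝ) ≤ n := by linarith
  rcases hn.eq_or_lt with hn | hn
  · simp [← hn]
  wlog hs : s ≤ n / 2 generalizing s
  · have := this (s := n - s) h2 (by linarith) (by linarith)
    rwa [show π * (n - s) / n = π - π * s / n by field_simp, sin_pi_sub] at this
  have h := mul_le_sin (x := π * s / n) (by have := pi_pos; have : 0 ≤ s := by linarith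
                                            positivity)
    (by rw [div_le_div_iff₀ hn two_pos]; nlinarith [pi_pos])
  refine le_trans ?_ h
  have : 2 / π * (π * s / n) = 2 * s / n := by have := pi_pos; field_simp
  rw [this]
  gcongr

theorem sin_index_nonneg {n : ℕ} {s : ℝ} (h1 : 0 ≤ s) (h2 : s ≤ n) : 0 ≤ sin (π * s / n) := by
  simpa using sin_ge_of_index (M := 0) le_rfl h1 (by linarith)

theorem sin_index_le (n : ℕ) {s : ℝ} (h : 0 ≤ s) : sin (π * s / n) ≤ π * s / n :=
  sin_le (by have := pi_pos; positivity)

theorem abs_sin_index_sub_le (n : ℕ) (s r : ℝ) :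
    |sin (π * s / n) - sin (π * r / n)| ≤ π * |s - r| / n := by
  refine (abs_sin_sub_sin_le _ _).trans (le_of_eq ?_)
  rw [show π * s / n - π * r / n = π / n * (s - r) by ring, abs_mul,
    abs_of_nonneg (by have := pi_pos; positivity : 0 ≤ π / (n : ℝ))]
  ring

theorem abs_pt_sub_pt {n : ℕ} {u v : ℝ} (hu : 0 ≤ u) (hu' : u ≤ n) (hv : 0 ≤ v) (hv' : v ≤ n) :
    |pt n u - pt n v| = 2 * sin (π * ((u + v) / 2) / n) * sin (π * (|u - v| / 2) / n) := by
  have h1 : 0 ≤ sin (π * ((u + v) / 2) / n) := sin_index_nonneg (by linarith) (by linarith)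
  rw [pt_sub_pt, abs_mul, abs_of_nonneg (by positivity)]
  congr 1
  have h2 : |u - v| ≤ n := abs_le.2 ⟨by linarith, by linarith⟩
  have h3 : 0 ≤ sin (π * (|u - v| / 2) / n) :=
    sin_index_nonneg (by positivity) (by linarith [abs_nonneg (u - v)])
  rcases abs_cases (u - v) with ⟨h, _⟩ | ⟨h, _⟩
  · rw [h] at h3 ⊢
    exact abs_of_nonneg h3
  · rw [h] at h3 ⊢
    rw [show π * (-(u - v) / 2) / (n : ℝ) = -(π * ((u - v) / 2) / n) by ring, sin_neg] at h3 ⊢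
    exact abs_of_nonpos (by linarith)

theorem pt_strictMonoOn {n : ℕ} (hn : 0 < n) : StrictMonoOn (pt n) (Set.Icc 0 n) := by
  intro u hu v hv huv
  have hn' : (0 : ℝ) < n := by exact_mod_cast hn
  have h := strictAntiOn_cos (a := π * u / n) (b := π * v / n)
    ⟨by have := pi_pos; have := hu.1; positivity,
      by rw [div_le_iff₀ hn']; exact mul_le_mul_of_nonneg_left hu.2 pi_pos.le⟩
    ⟨by have := pi_pos; have := hv.1; positivity,
      by rw [div_le_iff₀ hn']; exact mul_le_mul_of_nonneg_left hv.2 pi_pos.le⟩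
    (by have := pi_pos; gcongr)
  simp only [pt]
  linarith

theorem continuous_pt (n : ℕ) : Continuous (pt n) := by
  unfold pt; fun_prop

theorem exists_index (n : ℕ) {u v x : ℝ} (huv : u ≤ v) (hx : x ∈ Set.Icc (pt n u) (pt n v)) :
    ∃ w ∈ Set.Icc u v, pt n w = x :=
  intermediate_value_Icc huv (continuous_pt n).continuousOn hx

theorem sin_half_pos {n : ℕ} (hn : 0 < n) : 0 < sin (π / (2 * n)) := by
  have hn' : (1 : ℝ) ≤ n := by exact_mod_cast hn
  refine sin_pos_of_pos_of_lt_pi (by have := pi_pos; positivity) ?_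
  rw [div_lt_iff₀ (by positivity)]
  nlinarith [pi_pos]

theorem len_pos {n : ℕ} {m : ℝ} (h0 : 0 < m) (h1 : m < n) : 0 < len n m := by
  have hn' : (0 : ℝ) < n := h0.trans h1
  have hn : 0 < n := by exact_mod_cast hn'
  have : 0 < sin (π * m / n) := by
    refine sin_pos_of_pos_of_lt_pi (by have := pi_pos; positivity) ?_
    rw [div_lt_iff₀ hn']
    exact mul_lt_mul_of_pos_left h1 pi_pos
  have := sin_half_pos hn
  unfold len; positivity

/-- Near the ends of `[-1, 1]` the distance from a root, measured in adjacent nodal lengths, is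
at least a fixed multiple of the difference of the indices. -/
theorem len_mul_le {n : ℕ} {u v m : ℝ} (hu : 0 ≤ u) (hu' : u ≤ n) (hv : 3 / 2 ≤ v)
    (hv' : v ≤ n - 3 / 2) (hm : |m - v| ≤ 3 / 2) :
    len n m * |u - v| ≤ 9 * |pt n u - pt n v| := by
  rw [abs_pt_sub_pt hu hu' (by linarith) (by linarith)]
  have hn : (0 : ℝ) < n := by linarith
  have hd : |u - v| ≤ n := abs_le.2 ⟨by linarith, by linarith⟩
  set d := |u - v| with hd'
  have hd0 : 0 ≤ d := abs_nonneg _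
  have h1 : d / n ≤ sin (π * (d / 2) / n) := by
    have := sin_ge_of_index (n := n) (M := d / 2) (s := d / 2) (by positivity) le_rfl (by linarith)
    convert this using 1
    ring
  have h2 : sin (π / (2 * n)) ≤ π / (2 * n) := sin_le (by have := pi_pos; positivity)
  have h3 : 3 / n ≤ sin (π * v / n) := by
    have := sin_ge_of_index (n := n) (M := 3 / 2) (s := v) (by norm_num) hv (by linarith)
    convert this using 1
    ring
  have h4 : sin (π * m / n) ≤ sin (π * v / n) + π * (3 / 2) / n := by
    have := (abs_le.1 (abs_sin_index_sub_le n m v)).2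
    have h5 : π * |m - v| / n ≤ π * (3 / 2) / n := by have := pi_pos; gcongr
    linarith
  -- Concavity of the sine on `[0, π]` compares `v` with the midpoint index on whichever side `u`
  -- lies, which keeps the bound valid up to the ends.
  have h5 : sin (π * v / n) ≤ 2 * sin (π * ((u + v) / 2) / n) := by
    have hc := (strictConcaveOn_sin_Icc.concaveOn).2 (x := π * u / n)
      ⟨by have := pi_pos; positivity,
        by rw [div_le_iff₀ hn]; exact mul_le_mul_of_nonneg_left hu' pi_pos.le⟩ (y := π * v / n)
      ⟨by have := pi_pos; positivity,
        by rw [div_le_iff₀ hn]; exact mul_le_mul_of_nonneg_left (by linarith) pi_pos.le⟩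
      (show (0 : ℝ) ≤ 1 / 2 by norm_num) (show (0 : ℝ) ≤ 1 / 2 by norm_num) (by norm_num)
    simp only [smul_eq_mul] at hc
    have h0 := sin_index_nonneg hu hu'
    rw [show 1 / 2 * (π * u / n) + 1 / 2 * (π * v / n) = π * ((u + v) / 2) / n by ring] at hc
    linarith
  set S := sin (π * ((u + v) / 2) / n)
  have hS : 0 ≤ S := by
    have : (0 : ℝ) ≤ 3 / n := by positivity
    linarith
  have h6 : sin (π * m / n) ≤ (2 + π) * S := by
    have : π * (3 / 2) / n = π / 2 * (3 / n) := by ring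
    have h7 : π / 2 * (3 / n) ≤ π / 2 * (2 * S) := by have := pi_pos; gcongr; linarith
    nlinarith [pi_pos]
  have h7 := sin_half_pos (n := n) (by exact_mod_cast hn)
  unfold len
  calc 2 * sin (π * m / n) * sin (π / (2 * n)) * d
      ≤ 2 * ((2 + π) * S) * (π / (2 * n)) * d := by
        have := pi_pos
        gcongr
    _ = 2 * S * (((2 + π) * π / 2) * (d / n)) := by field_simp
    _ ≤ 2 * S * (9 * sin (π * (d / 2) / n)) := by
        have := pi_lt_d2
        have := pi_pos
        gcongr
        nlinarith
    _ = _ := by ring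

theorem mul_cos_le_sin {y : ℝ} (h0 : 0 ≤ y) (h1 : y ≤ π / 2) : y * cos y ≤ sin y := by
  rcases h1.eq_or_lt with h | h
  · rw [h]; simp
  · have hc : 0 < cos y := cos_pos_of_mem_Ioo ⟨by linarith [pi_pos], h⟩
    have := le_tan h0 h
    rwa [tan_eq_sin_div_cos, le_div_iff₀ hc] at this

/-- Away from the ends, the distance from a root, measured in adjacent nodal lengths, is almost
the difference of the indices. -/
theorem len_le_of_central {n : ℕ} {u v m K : ℝ} (hK : 0 < K) (hu : 4 * K ≤ u) (hu' : u ≤ n - 4 * K)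
    (hv : 0 ≤ v) (hv' : v ≤ n) (hm : |m - v| ≤ 3 / 2) (hd : 1 ≤ |u - v|) :
    len n m ≤ (1 / |u - v| + 2 / K) * |pt n u - pt n v| := by
  rw [abs_pt_sub_pt (by linarith) (by linarith) (by linarith) (by linarith)]
  have hn : (0 : ℝ) < n := by linarith
  have hdn : |u - v| ≤ n := abs_le.2 ⟨by linarith, by linarith⟩
  -- Expanding `v` as midpoint minus half difference gives a main term `S * c`, which will produce
  -- `1 / d`, and a remainder that centrality makes `O(1 / K)`.
  have hvs : |sin (π * v / n)| ≤ |sin (π * ((u + v) / 2) / n)| * cos (π * (|u - v| / 2) / n)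
      + |sin (π * (|u - v| / 2) / n)| := by
    have e : π * v / n = π * ((u + v) / 2) / n - π * ((u - v) / 2) / n := by ring
    rw [e, sin_sub]
    have hc : cos (π * ((u - v) / 2) / n) = cos (π * (|u - v| / 2) / n) ∧
        |sin (π * ((u - v) / 2) / n)| = |sin (π * (|u - v| / 2) / n)| := by
      rcases abs_cases (u - v) with ⟨h, _⟩ | ⟨h, _⟩
      · rw [h]; simp
      · rw [h, show π * (-(u - v) / 2) / (n : ℝ) = -(π * ((u - v) / 2) / n) by ring]; simp
    have hc0 : 0 ≤ cos (π * (|u - v| / 2) / n) := by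
      refine cos_nonneg_of_mem_Icc ⟨by have := pi_pos; linarith [show 0 ≤ π * (|u - v| / 2) / n by positivity], ?_⟩
      rw [div_le_div_iff₀ hn two_pos]
      nlinarith [pi_pos]
    refine (abs_sub _ _).trans ?_
    rw [abs_mul, abs_mul, hc.1, hc.2, abs_of_nonneg hc0]
    gcongr
    exact mul_le_of_le_one_left (abs_nonneg _) (abs_cos_le_one _)
  set d := |u - v| with hd'
  have hd0 : 0 < d := by linarith
  have hS : 4 * K / n ≤ sin (π * ((u + v) / 2) / n) := by
    have := sin_ge_of_index (n := n) (M := 2 * K) (s := (u + v) / 2) (by linarith) (by linarith)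
      (by linarith)
    convert this using 1
    ring
  set S := sin (π * ((u + v) / 2) / n)
  have hS0 : 0 < S := lt_of_lt_of_le (by positivity) hS
  have hD0 : 0 ≤ sin (π * (d / 2) / n) := sin_index_nonneg (by linarith) (by linarith)
  rw [abs_of_pos hS0, abs_of_nonneg hD0] at hvs
  have h4 : sin (π * m / n) ≤ sin (π * v / n) + π * (3 / 2) / n := by
    have := (abs_le.1 (abs_sin_index_sub_le n m v)).2
    have h5 : π * |m - v| / n ≤ π * (3 / 2) / n := by have := pi_pos; gcongr
    linarith
  have hhalf := sin_half_pos (n := n) (by exact_mod_cast hn)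
  have hh : sin (π / (2 * n)) ≤ π / (2 * n) := sin_le (by have := pi_pos; positivity)
  have hy0 : 0 ≤ π * (d / 2) / n := by have := pi_pos; positivity
  have hy1 : π * (d / 2) / n ≤ π / 2 := by
    rw [div_le_div_iff₀ hn two_pos]
    nlinarith [pi_pos]
  have hcos := mul_cos_le_sin hy0 hy1
  have hc0 : 0 ≤ cos (π * (d / 2) / n) := cos_nonneg_of_mem_Icc ⟨by linarith [pi_pos], hy1⟩
  have hmono : sin (π / (2 * n)) ≤ sin (π * (d / 2) / n) := by
    refine sin_le_sin_of_le_of_le_pi_div_two ?_ hy1 ?_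
    · have : 0 ≤ π / (2 * n) := by have := pi_pos; positivity
      linarith [pi_pos]
    · rw [div_le_div_iff₀ (by positivity) hn]
      nlinarith [pi_pos, mul_pos pi_pos hn]
  set D := sin (π * (d / 2) / n)
  set c := cos (π * (d / 2) / n)
  set H := sin (π / (2 * n))
  have t1 : S * c * H ≤ S * (D / d) := by
    have : c * H ≤ D / d := by
      rw [le_div_iff₀ hd0]
      calc c * H * d ≤ c * (π / (2 * n)) * d := by gcongr
        _ = π * (d / 2) / n * c := by field_simp
        _ ≤ D := hcos
    calc S * c * H = S * (c * H) := by ring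
      _ ≤ _ := by gcongr
  have hnS : π / n ≤ π / (4 * K) * S := by
    calc π / n = π / (4 * K) * (4 * K / n) := by field_simp
      _ ≤ _ := by have := pi_pos; gcongr
  -- From here on `S ≥ 4 * K / n` turns every surplus of order `1 / n` into a multiple of `S / K`.
  have t2 : D * H ≤ π / (8 * K) * S * D := by
    have : H ≤ π / (8 * K) * S := by
      have e1 : π / (2 * n) = (π / n) / 2 := by field_simp
      have e2 : π / (8 * K) * S = (π / (4 * K) * S) / 2 := by field_simp; norm_num
      linarith
    nlinarith
  have t3 : π * (3 / 2) / n * H ≤ 3 / 2 * (π / (4 * K) * S) * D := by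
    have : π * (3 / 2) / n ≤ 3 / 2 * (π / (4 * K) * S) := by
      have e1 : π * (3 / 2) / n = 3 / 2 * (π / n) := by ring
      linarith
    have h0 : 0 ≤ 3 / 2 * (π / (4 * K) * S) := by have := pi_pos; positivity
    have := pi_pos
    gcongr
  have t4 : sin (π * m / n) * H ≤ (S * c + D + π * (3 / 2) / n) * H := by
    have := le_abs_self (sin (π * v / n))
    gcongr
    linarith
  have t5 : π / (8 * K) * S * D + 3 / 2 * (π / (4 * K) * S) * D ≤ 2 / K * (S * D) := by
    have e : π / (8 * K) * S * D + 3 / 2 * (π / (4 * K) * S) * D = π / 2 / K * (S * D) := by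
      field_simp; ring
    rw [e]
    have := pi_le_four
    gcongr
    linarith
  unfold len
  have e : (1 / d + 2 / K) * (2 * S * D) = 2 * (S * (D / d) + 2 / K * (S * D)) := by ring
  rw [e]
  nlinarith

/-- Lower counterpart of `len_le_of_central` at bounded distance. -/
theorem le_len_of_central {n : ℕ} {u v m K : ℝ} (hK : 2 ≤ K) (hu : 4 * K ≤ u)
    (hu' : u ≤ n - 4 * K) (hv : 0 ≤ v) (hv' : v ≤ n) (hm : |m - (u + v) / 2| ≤ 3) :
    (1 - 4 / K) * |pt n u - pt n v| ≤ len n m * |u - v| := by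
  rcases le_or_gt K 4 with hK4 | hK4
  · have h0 : (1 - 4 / K) ≤ 0 := by
      rw [sub_nonpos, le_div_iff₀ (by linarith)]; linarith
    have h1 : 0 < len n m := len_pos (by linarith [(abs_le.1 hm).1]) (by linarith [(abs_le.1 hm).2])
    exact (mul_nonpos_of_nonpos_of_nonneg h0 (abs_nonneg _)).trans (by positivity)
  rw [abs_pt_sub_pt (by linarith) (by linarith) (by linarith) (by linarith)]
  have hn : (0 : ℝ) < n := by linarith
  have hdn : |u - v| ≤ n := abs_le.2 ⟨by linarith, by linarith⟩
  set d := |u - v| with hd'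
  have hd0 : 0 ≤ d := abs_nonneg _
  have hS : 4 * K / n ≤ sin (π * ((u + v) / 2) / n) := by
    have := sin_ge_of_index (n := n) (M := 2 * K) (s := (u + v) / 2) (by linarith) (by linarith)
      (by linarith)
    convert this using 1
    ring
  set S := sin (π * ((u + v) / 2) / n)
  have hS0 : 0 < S := lt_of_lt_of_le (by positivity) hS
  have h4 : S - π * 3 / n ≤ sin (π * m / n) := by
    have := (abs_le.1 (abs_sin_index_sub_le n m ((u + v) / 2))).1
    have h5 : π * |m - (u + v) / 2| / n ≤ π * 3 / n := by have := pi_pos; gcongr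
    linarith
  have hD : sin (π * (d / 2) / n) ≤ π / (2 * n) * d := by
    have := sin_index_le n (s := d / 2) (by linarith)
    convert this using 1
    ring
  have hD0 : 0 ≤ sin (π * (d / 2) / n) := sin_index_nonneg (by linarith) (by linarith)
  have hx0 : 0 < π / (2 * n) := by have := pi_pos; positivity
  have hhalf := sin_ge_sub_cube hx0.le
  have hnS : π * 3 / n ≤ 3 / K * S := by
    have e : π * 3 / n = (π * 3 / (4 * K)) * (4 * K / n) := by field_simp
    rw [e]
    have : π * 3 / (4 * K) ≤ 3 / K := by
      rw [div_le_div_iff₀ (by linarith) (by linarith)]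
      nlinarith [pi_le_four]
    have := pi_pos
    gcongr
  have hx1 : (π / (2 * n)) ^ 2 ≤ 1 / K := by
    have h1 : π / (2 * n) ≤ 1 / K := by
      rw [div_le_div_iff₀ (by linarith) (by linarith)]
      nlinarith [pi_le_four]
    have h2 : 1 / K ≤ 1 := by rw [div_le_one (by linarith)]; linarith
    nlinarith
  set x := π / (2 * n)
  have hH : (1 - 1 / K) * x ≤ sin x := by nlinarith
  have hK1 : 0 < 1 / K := by positivity
  have hK2 : 1 / K < 1 / 4 := one_div_lt_one_div_of_lt (by norm_num) hK4
  have h5 : (1 - 3 / K) * S ≤ sin (π * m / n) := by linarith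
  have e3 : 3 / K = 3 * (1 / K) := by ring
  have e4 : 4 / K = 4 * (1 / K) := by ring
  rw [e3] at h5
  rw [e4]
  set κ := 1 / K
  unfold len
  calc (1 - 4 * κ) * (2 * S * sin (π * (d / 2) / n))
      ≤ (1 - 4 * κ) * (2 * S * (x * d)) := by
        have : 0 ≤ 1 - 4 * κ := by linarith
        gcongr
    -- The loss `3 κ` pays for replacing the midpoint index by `m`, the loss `κ` for replacing `sin
    -- x` by `x`.
    _ ≤ ((1 - 3 * κ) * (1 - κ)) * (2 * S * (x * d)) := by
        gcongr
        nlinarith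
    _ = 2 * ((1 - 3 * κ) * S) * ((1 - κ) * x) * d := by ring
    _ ≤ 2 * sin (π * m / n) * sin x * d := by
        have : 0 ≤ 1 - κ := by linarith
        have : 0 ≤ 1 - 3 * κ := by linarith
        gcongr
        have : 0 ≤ (1 - 3 * κ) * S := by positivity
        linarith

/-! ### Effect of a perturbation on the cubic of a block -/

/-- The cubic with roots the interior roots of a block. -/
noncomputable def blockCubic (n i : ℕ) (x : ℝ) : ℝ :=
  (x - root n (4 * i + 2)) * (x - root n (4 * i + 3)) * (x - root n (4 * i + 4))

/-- The constant by which perturbing a block changes its normalized cubic. -/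
def shift (s a : ℝ) : ℝ := s * (1 + s) * (1 + a + s)

theorem shift_zero (a : ℝ) : shift 0 a = 0 := by simp [shift]

theorem lt_of_block {n : ℕ} (i : Fin (numBlocks n)) : 4 * (i : ℕ) + 5 ≤ n := by
  have := i.2
  unfold numBlocks at this
  omega

theorem nodalLength_pos {n j : ℕ} (h0 : 0 < j) (h1 : j < n) : 0 < nodalLength n j := by
  rw [nodalLength_eq_len]
  exact len_pos (by exact_mod_cast h0) (by exact_mod_cast h1)

theorem centerLength_pos {n : ℕ} (i : Fin (numBlocks n)) :
    0 < nodalLength n (4 * (i : ℕ) + 3) :=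
  nodalLength_pos (by omega) (by have := lt_of_block i; omega)

theorem blockRatio_mul {n : ℕ} (i : Fin (numBlocks n)) :
    blockRatio n i * nodalLength n (4 * (i : ℕ) + 3) = nodalLength n (4 * (i : ℕ) + 2) :=
  div_mul_cancel₀ _ (centerLength_pos i).ne'

/-- The three displacements sum to zero, so the quadratic coefficient is kept; the equation for `δ`
keeps the linear one. The same equation removes `δ` from the constant, leaving a polynomial in `s`
without the square root. -/
theorem perturbed_block {n : ℕ} (i : Fin (numBlocks n)) {s : ℝ}
    (hs : 0 ≤ deltaDisc s (blockRatio n i)) (x : ℝ) :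
    (x - leftRoot n i s) * (x - centerRoot n i s) * (x - rightRoot n i s) =
      blockCubic n i x - shift s (blockRatio n i) * nodalLength n (4 * (i : ℕ) + 3) ^ 3 := by
  have h := delta_equation hs
  have ha := blockRatio_mul i
  unfold leftRoot centerRoot rightRoot blockCubic shift
  have e2 : root n (4 * (i : ℕ) + 2) =
      root n (4 * (i : ℕ) + 3) - blockRatio n i * nodalLength n (4 * (i : ℕ) + 3) := by
    rw [ha, nodalLength]; ring
  have e4 : root n (4 * (i : ℕ) + 4) =
      root n (4 * (i : ℕ) + 3) + nodalLength n (4 * (i : ℕ) + 3) := by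
    rw [nodalLength]; ring
  rw [e2, e4]
  generalize delta s (blockRatio n i) = δ at *
  generalize blockRatio n i = a at *
  generalize nodalLength n (4 * (i : ℕ) + 3) = L at *
  generalize root n (4 * (i : ℕ) + 3) = r at *
  linear_combination ((x - r) * L ^ 2 - (1 + s) * L ^ 3) * h

/-- The unperturbed polynomial without the cubic factor of the block `k`. -/
noncomputable def cofactor (n : ℕ) (k : Fin (numBlocks n)) (x : ℝ) : ℝ :=
  2 ^ (n - 1) * (∏ j ∈ Finset.range (numBlocks n + 1), (x - root n (4 * j + 1))) *
    ∏ i ∈ Finset.univ.erase k, blockCubic n i x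

theorem perturbedT_eq {n : ℕ} {y : Fin (numBlocks n) → ℝ}
    (hy : ∀ i, 0 ≤ deltaDisc (y i) (blockRatio n i)) (x : ℝ) :
    perturbedT n y x =
      2 ^ (n - 1) * (∏ j ∈ Finset.range (numBlocks n + 1), (x - root n (4 * j + 1))) *
        ∏ i : Fin (numBlocks n), (blockCubic n i x -
          shift (y i) (blockRatio n i) * nodalLength n (4 * (i : ℕ) + 3) ^ 3) := by
  unfold perturbedT
  congr 1
  exact Finset.prod_congr rfl fun i _ => perturbed_block i (hy i) x

theorem deltaDisc_zero_nonneg (a : ℝ) : 0 ≤ deltaDisc 0 a := by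
  simp [deltaDisc]; positivity

theorem perturbedT_single {n : ℕ} (k : Fin (numBlocks n)) {s : ℝ}
    (hs : 0 ≤ deltaDisc s (blockRatio n k)) (x : ℝ) :
    perturbedT n (Pi.single k s) x = cofactor n k x * (blockCubic n k x -
      shift s (blockRatio n k) * nodalLength n (4 * (k : ℕ) + 3) ^ 3) := by
  rw [perturbedT_eq, cofactor, ← Finset.mul_prod_erase _ _ (Finset.mem_univ k)]
  · rw [Pi.single_eq_same, Finset.prod_congr rfl (g := fun i : Fin (numBlocks n) =>
      blockCubic n i x)]
    · ring
    · intro i hi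
      rw [Pi.single_eq_of_ne (Finset.ne_of_mem_erase hi), shift_zero]
      ring
  · intro i
    rcases eq_or_ne i k with rfl | h
    · rwa [Pi.single_eq_same]
    · rw [Pi.single_eq_of_ne h]
      exact deltaDisc_zero_nonneg _

/-- The product is the exact ratio of the coupled to the decoupled polynomial, so comparing `g` with
`f` reduces to its distance from `1`. -/
theorem perturbedT_eq_mul_prod {n : ℕ} (k : Fin (numBlocks n)) {y : Fin (numBlocks n) → ℝ}
    (hy : ∀ i, 0 ≤ deltaDisc (y i) (blockRatio n i)) {x : ℝ}
    (hx : ∀ i, i ≠ k → blockCubic n i x ≠ 0) :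
    perturbedT n y x = perturbedT n (Pi.single k (y k)) x *
      ∏ i ∈ Finset.univ.erase k, (1 + -(shift (y i) (blockRatio n i) *
        nodalLength n (4 * (i : ℕ) + 3) ^ 3 / blockCubic n i x)) := by
  rw [perturbedT_single k (hy k), perturbedT_eq hy, cofactor,
    ← Finset.mul_prod_erase _ _ (Finset.mem_univ k)]
  have : ∏ i ∈ Finset.univ.erase k, (blockCubic n i x -
      shift (y i) (blockRatio n i) * nodalLength n (4 * (i : ℕ) + 3) ^ 3) =
      (∏ i ∈ Finset.univ.erase k, blockCubic n i x) *
      ∏ i ∈ Finset.univ.erase k, (1 + -(shift (y i) (blockRatio n i) *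
        nodalLength n (4 * (i : ℕ) + 3) ^ 3 / blockCubic n i x)) := by
    rw [← Finset.prod_mul_distrib]
    refine Finset.prod_congr rfl fun i hi => ?_
    have := hx i (Finset.ne_of_mem_erase hi)
    field_simp
    ring
  rw [this]
  ring

/-! ### Identification with the Chebyshev polynomial -/

theorem chebyshev_prod (n : ℕ) (x : ℝ) :
    2 ^ (n - 1) * ∏ j ∈ Finset.range n, (x - root n (j + 1)) =
      (-1) ^ n * (Polynomial.Chebyshev.T ℝ n).eval (-x) := by
  have hr := Polynomial.Chebyshev.roots_T_real n
  have hdeg : (Polynomial.Chebyshev.T ℝ n).natDegree = n := by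
    rw [Polynomial.Chebyshev.natDegree_T]; simp
  have hinj := (Finset.range n).nodup_map_iff_injOn.mp
    (Polynomial.Chebyshev.roots_T_real_nodup n)
  have hcard : (Polynomial.Chebyshev.T ℝ n).roots.card =
      (Polynomial.Chebyshev.T ℝ n).natDegree := by
    rw [hr, hdeg, Finset.card_val, Finset.card_image_of_injOn hinj, Finset.card_range]
  have hT := Polynomial.C_leadingCoeff_mul_prod_multiset_X_sub_C hcard
  rw [← hT, hr]
  have hprod : (Multiset.map (fun a => Polynomial.X - Polynomial.C a)
      ((Finset.range n).image (fun (k : ℕ) => cos ((2 * k + 1) * π / (2 * n)))).val).prod =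
      ∏ k ∈ Finset.range n, (Polynomial.X - Polynomial.C (cos ((2 * (k : ℝ) + 1) * π / (2 * n)))) := by
    rw [← Finset.prod_image (f := fun a => (Polynomial.X - Polynomial.C a : Polynomial ℝ)) hinj]
    rfl
  rw [hprod, Polynomial.Chebyshev.leadingCoeff_T, Polynomial.eval_mul, Polynomial.eval_prod]
  simp only [Polynomial.eval_C, Polynomial.eval_sub, Polynomial.eval_X, Int.natAbs_natCast]
  have hneg : ∏ k ∈ Finset.range n, (-x - cos ((2 * (k : ℝ) + 1) * π / (2 * n))) =
      (-1) ^ n * ∏ k ∈ Finset.range n, (x - root n (k + 1)) := by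
    -- The roots `cos ((2k+1)π/(2n))` are the negatives of `root n (k + 1)`; this reflection is the
    -- source of `-x` and of the sign `(-1) ^ n`.
    rw [← Finset.card_range n, ← Finset.prod_const, Finset.card_range, ← Finset.prod_mul_distrib]
    refine Finset.prod_congr rfl fun k _ => ?_
    unfold root
    push_cast
    rw [show π * (2 * ((k : ℝ) + 1) - 1) / (2 * n) = (2 * k + 1) * π / (2 * n) by ring]
    ring
  rw [hneg]
  have : ((-1 : ℝ) ^ n) * (-1) ^ n = 1 := by rw [← mul_pow]; simp
  linear_combination (-(2 ^ (n - 1) * ∏ j ∈ Finset.range n, (x - root n (j + 1)))) * this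

theorem prod_blocks (n N : ℕ) (x : ℝ) :
    (∏ j ∈ Finset.range (N + 1), (x - root n (4 * j + 1))) *
      ∏ i ∈ Finset.range N, blockCubic n i x =
      ∏ j ∈ Finset.range (4 * N + 1), (x - root n (j + 1)) := by
  induction N with
  | zero => simp
  | succ N ih =>
    have hb : blockCubic n N x = (x - root n (4 * N + 1 + 1)) * (x - root n (4 * N + 1 + 1 + 1)) *
        (x - root n (4 * N + 1 + 1 + 1 + 1)) := rfl
    rw [Finset.prod_range_succ (fun j => x - root n (4 * j + 1)) (N + 1),
      Finset.prod_range_succ (fun i => blockCubic n i x) N, hb,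
      show 4 * (N + 1) + 1 = 4 * N + 1 + 1 + 1 + 1 + 1 by ring,
      Finset.prod_range_succ _ (4 * N + 1 + 1 + 1 + 1),
      Finset.prod_range_succ _ (4 * N + 1 + 1 + 1), Finset.prod_range_succ _ (4 * N + 1 + 1),
      Finset.prod_range_succ _ (4 * N + 1), ← ih]
    ring

/-- The unperturbed polynomial is the Chebyshev polynomial. -/
theorem cofactor_mul_blockCubic {n : ℕ} (hn : n % 4 = 1) (k : Fin (numBlocks n)) (u : ℝ) :
    cofactor n k (pt n u) * blockCubic n k (pt n u) = -cos (π * u) := by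
  have hN : 4 * numBlocks n + 1 = n := by unfold numBlocks; omega
  have h := chebyshev_prod n (pt n u)
  have hp := prod_blocks n (numBlocks n) (pt n u)
  rw [hN] at hp
  rw [← hp] at h
  have hn0 : (n : ℝ) ≠ 0 := by norm_cast; omega
  rw [pt, neg_neg, Polynomial.Chebyshev.T_real_cos,
    show ((n : ℤ) : ℝ) * (π * u / n) = π * u by push_cast; field_simp,
    Odd.neg_one_pow (Nat.odd_iff.2 (by omega)), ← pt] at h
  rw [cofactor, mul_assoc, mul_comm (∏ i ∈ Finset.univ.erase k, _),
    Finset.mul_prod_erase _ (fun i : Fin (numBlocks n) => blockCubic n i (pt n u))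
      (Finset.mem_univ k), Fin.prod_univ_eq_prod_range (fun i => blockCubic n i (pt n u)), mul_assoc,
      h]
  ring

/-! ### Bounds for the block ratio and for the sensitivity -/

/-- The ratio is one of sines at adjacent indices. By the addition formula they differ by at most
`sin (π / n)`, which is at most either of them. No centrality is needed, so `δ` is defined on end
blocks too. -/
theorem blockRatio_mem {n : ℕ} (i : Fin (numBlocks n)) :
    blockRatio n i ∈ Set.Icc (1 / 2 : ℝ) 2 := by
  have hi : (4 : ℝ) * (i : ℕ) + 5 ≤ n := by exact_mod_cast lt_of_block i
  have hi0 : (0 : ℝ) ≤ (i : ℕ) := by positivity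
  have hn : (0 : ℝ) < n := by linarith
  have key : ∀ p q : ℝ, 1 ≤ q → q ≤ n - 1 → |p - q| ≤ 1 → sin (π * p / n) ≤ 2 * sin (π * q / n) := by
    intro p q h1 h2 h3
    have e : π * p / n = π * q / n + π * (p - q) / n := by ring
    have hq : sin (π * 1 / n) ≤ sin (π * q / n) := by
      rcases le_total q (n / 2) with h | h
      · refine sin_le_sin_of_le_of_le_pi_div_two ?_ ?_ ?_
        · have : 0 ≤ π * 1 / n := by have := pi_pos; positivity
          linarith [pi_pos]
        · rw [div_le_div_iff₀ hn two_pos]; nlinarith [pi_pos]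
        · have := pi_pos; gcongr
      · rw [show π * q / n = π - π * (n - q) / n by field_simp; ring, sin_pi_sub]
        refine sin_le_sin_of_le_of_le_pi_div_two ?_ ?_ ?_
        · have : 0 ≤ π * 1 / n := by have := pi_pos; positivity
          linarith [pi_pos]
        · rw [div_le_div_iff₀ hn two_pos]; nlinarith [pi_pos]
        · have := pi_pos; gcongr; linarith
    have hq0 : 0 ≤ sin (π * q / n) := sin_index_nonneg (by linarith) (by linarith)
    have hd : sin (π * (p - q) / n) * cos (π * q / n) ≤ sin (π * 1 / n) := by
      have h4 : |sin (π * (p - q) / n)| ≤ sin (π * 1 / n) := by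
        have hle : ∀ z : ℝ, 0 ≤ z → z ≤ 1 → sin (π * z / n) ≤ sin (π * 1 / n) := by
          intro z hz hz1
          refine sin_le_sin_of_le_of_le_pi_div_two ?_ ?_ ?_
          · have : 0 ≤ π * z / n := by have := pi_pos; positivity
            linarith [pi_pos]
          · rw [div_le_div_iff₀ hn two_pos]; nlinarith [pi_pos]
          · have := pi_pos; gcongr
        have h5 := abs_le.1 h3
        rcases le_total 0 (p - q) with h | h
        · rw [abs_of_nonneg (sin_index_nonneg h (by linarith))]
          exact hle _ h h5.2
        · have h6 := sin_index_nonneg (n := n) (s := -(p - q)) (by linarith) (by linarith)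
          have h7 := hle (-(p - q)) (by linarith) (by linarith)
          rw [show π * -(p - q) / (n : ℝ) = -(π * (p - q) / n) by ring, sin_neg] at h6 h7
          rw [abs_of_nonpos (by linarith)]
          exact h7
      refine (le_abs_self _).trans ?_
      rw [abs_mul]
      exact (mul_le_of_le_one_right (abs_nonneg _) (abs_cos_le_one _)).trans h4
    rw [e, sin_add]
    have : sin (π * q / n) * cos (π * (p - q) / n) ≤ sin (π * q / n) :=
      mul_le_of_le_one_right hq0 (cos_le_one _)
    nlinarith
  have h1 := key (4 * (i : ℕ) + 2) (4 * (i : ℕ) + 3) (by linarith) (by linarith) (by norm_num)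
  have h2 := key (4 * (i : ℕ) + 3) (4 * (i : ℕ) + 2) (by linarith) (by linarith) (by norm_num)
  have hL := centerLength_pos i
  have hs := sin_half_pos (n := n) (by exact_mod_cast hn)
  unfold blockRatio
  constructor
  · rw [le_div_iff₀ hL, nodalLength_eq_len, nodalLength_eq_len, len, len]
    push_cast
    nlinarith
  · rw [div_le_iff₀ hL, nodalLength_eq_len, nodalLength_eq_len, len, len]
    push_cast
    nlinarith

theorem blockCubic_pt (n i : ℕ) (u : ℝ) :
    blockCubic n i (pt n u) = (pt n u - pt n (4 * i + 3 / 2)) * (pt n u - pt n (4 * i + 5 / 2)) *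
      (pt n u - pt n (4 * i + 7 / 2)) := by
  unfold blockCubic
  rw [root_eq_pt, root_eq_pt, root_eq_pt]
  push_cast
  ring_nf

/-- Both zeros of the sine are kept as factors, so that they cancel against the roots of the cubic
in `le_abs_sensitivity`. -/
theorem three_mul_le_sin {z : ℝ} (h0 : 0 ≤ z) (h1 : z ≤ 1) : 3 * z * (1 - z) ≤ sin (π * z) := by
  wlog h : z ≤ 1 / 2 generalizing z
  · have := this (z := 1 - z) (by linarith) (by linarith) (by linarith)
    rw [show π * (1 - z) = π - π * z by ring, sin_pi_sub] at this
    linarith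
  have h2 := sin_ge_sub_cube (x := π * z) (by have := pi_pos; positivity)
  refine le_trans ?_ h2
  have h3 : π ^ 3 ≤ 33 := by
    have a := pi_lt_d2
    have b := pi_pos
    calc π ^ 3 ≤ 3.15 ^ 3 := by gcongr
      _ ≤ 33 := by norm_num
  have h4 : 0 ≤ π - π ^ 3 * z ^ 2 / 6 - 3 + 3 * z := by
    have := pi_gt_three
    have : π ^ 3 * z ^ 2 ≤ 33 * z ^ 2 := by gcongr
    nlinarith
  have : π * z - (π * z) ^ 3 / 6 - 3 * z * (1 - z) = z * (π - π ^ 3 * z ^ 2 / 6 - 3 + 3 * z) := by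
    ring
  nlinarith

theorem cos_center (i : ℕ) (w : ℝ) : cos (π * (4 * i + 5 / 2 + w)) = -sin (π * w) := by
  rw [show π * (4 * (i : ℝ) + 5 / 2 + w) = (π * w + π / 2) + ((2 * i + 1 : ℕ) : ℝ) * (2 * π) by
    push_cast; ring, cos_add_nat_mul_two_pi, cos_add_pi_div_two]

/-- Minus the derivative of the perturbed polynomial with respect to the normalized constant added
to the cubic of the block `k`. -/
noncomputable def sensitivity (n : ℕ) (k : Fin (numBlocks n)) (x : ℝ) : ℝ :=
  -(nodalLength n (4 * (k : ℕ) + 3) ^ 3 * cofactor n k x)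

theorem sensitivity_mul {n : ℕ} (hn : n % 4 = 1) (k : Fin (numBlocks n)) (w : ℝ) :
    sensitivity n k (pt n (4 * (k : ℕ) + 5 / 2 + w)) *
      blockCubic n k (pt n (4 * (k : ℕ) + 5 / 2 + w)) =
      -(nodalLength n (4 * (k : ℕ) + 3) ^ 3 * sin (π * w)) := by
  have h := cofactor_mul_blockCubic hn k (4 * (k : ℕ) + 5 / 2 + w)
  rw [cos_center] at h
  unfold sensitivity
  linear_combination (-(nodalLength n (4 * (k : ℕ) + 3) ^ 3)) * h

/-- The sign of `pt u - pt v` is the sign of `u - v`. -/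
theorem sub_mul_pt_sub_pos {n : ℕ} (hn : 0 < n) {u v : ℝ} (hu : u ∈ Set.Icc (0 : ℝ) n)
    (hv : v ∈ Set.Icc (0 : ℝ) n) (huv : u ≠ v) : 0 < (u - v) * (pt n u - pt n v) := by
  rcases lt_or_gt_of_ne huv with h | h
  · exact mul_pos_of_neg_of_neg (by linarith) (by linarith [pt_strictMonoOn hn hu hv h])
  · exact mul_pos (by linarith) (by linarith [pt_strictMonoOn hn hv hu h])

/-- On `(-2, 2)` both factors change sign exactly at `-1, 0, 1`, and between these points their
signs are opposite. This is the source of the positivity of the sensitivity. -/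
theorem sin_mul_cubic_nonpos {w : ℝ} (hw : |w| ≤ 2) :
    sin (π * w) * ((w + 1) * w * (w - 1)) ≤ 0 := by
  wlog h : 0 ≤ w generalizing w
  · have := this (w := -w) (by rwa [abs_neg]) (by linarith)
    rw [show π * -w = -(π * w) by ring, sin_neg] at this
    nlinarith
  have h2 := (abs_le.1 hw).2
  rcases le_total w 1 with h1 | h1
  · have hs : 0 ≤ sin (π * w) := sin_nonneg_of_nonneg_of_le_pi (by have := pi_pos; positivity)
      (by nlinarith [pi_pos])
    refine mul_nonpos_of_nonneg_of_nonpos hs (mul_nonpos_of_nonneg_of_nonpos (by positivity) (by linarith))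
  · have hs : 0 ≤ sin (π * (w - 1)) := sin_nonneg_of_nonneg_of_le_pi
      (mul_nonneg pi_pos.le (by linarith)) (by nlinarith [pi_pos])
    rw [show π * (w - 1) = π * w - π by ring, sin_sub_pi] at hs
    refine mul_nonpos_of_nonpos_of_nonneg (by linarith) (mul_nonneg (by positivity) (by linarith))

theorem abs_sin_pi_mul_le (w : ℝ) : |sin (π * w)| ≤ π * |w| := by
  refine abs_sin_le_abs.trans ?_
  rw [abs_mul, abs_of_pos pi_pos]

theorem mem_of_block {n : ℕ} (k : Fin (numBlocks n)) {w : ℝ} (hw : |w| ≤ 2) :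
    4 * ((k : ℕ) : ℝ) + 5 / 2 + w ∈ Set.Icc (0 : ℝ) n := by
  have hk : (4 : ℝ) * (k : ℕ) + 5 ≤ n := by exact_mod_cast lt_of_block k
  have := abs_le.1 hw
  constructor
  · have : (0 : ℝ) ≤ (k : ℕ) := by positivity
    linarith
  · linarith

theorem sensitivity_nonneg {n : ℕ} (hn : n % 4 = 1) (k : Fin (numBlocks n)) {w : ℝ} (hw : |w| ≤ 2)
    (h0 : w ≠ -1) (h1 : w ≠ 0) (h2 : w ≠ 1) :
    0 ≤ sensitivity n k (pt n (4 * (k : ℕ) + 5 / 2 + w)) := by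
  have hm := mem_of_block k hw
  have hn0 : 0 < n := by omega
  have hL := centerLength_pos k
  have hV := sensitivity_mul hn k w
  have hs := sin_mul_cubic_nonpos hw
  have p0 := sub_mul_pt_sub_pos hn0 hm (mem_of_block k (w := -1) (by norm_num)) (by simpa using h0)
  have p1 := sub_mul_pt_sub_pos hn0 hm (mem_of_block k (w := 0) (by norm_num)) (by simpa using h1)
  have p2 := sub_mul_pt_sub_pos hn0 hm (mem_of_block k (w := 1) (by norm_num)) (by simpa using h2)
  have hp := mul_pos (mul_pos p0 p1) p2
  rw [blockCubic_pt, show 4 * ((k : ℕ) : ℝ) + 3 / 2 = 4 * (k : ℕ) + 5 / 2 + -1 by ring,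
    show 4 * ((k : ℕ) : ℝ) + 7 / 2 = 4 * (k : ℕ) + 5 / 2 + 1 by ring] at hV
  rw [add_zero] at hp
  set P := pt n (4 * (k : ℕ) + 5 / 2 + w)
  set L := nodalLength n (4 * (k : ℕ) + 3)
  set c := (w + 1) * w * (w - 1) with hc
  set U := (P - pt n (4 * (k : ℕ) + 5 / 2 + -1)) * (P - pt n (4 * (k : ℕ) + 5 / 2)) *
    (P - pt n (4 * (k : ℕ) + 5 / 2 + 1)) with hU
  have hcU : 0 < c * U := lt_of_lt_of_eq hp (by rw [hc, hU]; ring)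
  have h3 : 0 ≤ sensitivity n k P * (c * U) := by
    have e : sensitivity n k P * (c * U) = L ^ 3 * (-(sin (π * w) * c)) := by
      linear_combination c * hV
    rw [e]
    have : 0 ≤ -(sin (π * w) * c) := by linarith
    positivity
  exact nonneg_of_mul_nonneg_left h3 hcU

theorem abs_sensitivity_mul {n : ℕ} (hn : n % 4 = 1) (k : Fin (numBlocks n)) (w : ℝ) :
    |sensitivity n k (pt n (4 * (k : ℕ) + 5 / 2 + w))| *
      (|pt n (4 * (k : ℕ) + 5 / 2 + w) - pt n (4 * (k : ℕ) + 3 / 2)| *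
        |pt n (4 * (k : ℕ) + 5 / 2 + w) - pt n (4 * (k : ℕ) + 5 / 2)| *
        |pt n (4 * (k : ℕ) + 5 / 2 + w) - pt n (4 * (k : ℕ) + 7 / 2)|) =
      nodalLength n (4 * (k : ℕ) + 3) ^ 3 * |sin (π * w)| := by
  have h := congrArg abs (sensitivity_mul hn k w)
  rw [blockCubic_pt, abs_neg, abs_mul, abs_mul, abs_mul, abs_mul,
    abs_of_pos (pow_pos (centerLength_pos k) 3)] at h
  exact h

theorem abs_pt_sub_pos {n : ℕ} (hn : 0 < n) {u v : ℝ} (hu : u ∈ Set.Icc (0 : ℝ) n)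
    (hv : v ∈ Set.Icc (0 : ℝ) n) (huv : u ≠ v) : 0 < |pt n u - pt n v| :=
  abs_pos.2 (sub_ne_zero.2 fun h => huv ((pt_strictMonoOn hn).injOn hu hv h))

/-- The sine cancels the factor of the nearest root, and the other two roots are at index distance
at least `1/2`. The constant is crude, `9 * 18 * 18 * π < 9200`; it will only be multiplied by a
tiny shift. -/
theorem abs_sensitivity_le {n : ℕ} (hn : n % 4 = 1) (k : Fin (numBlocks n)) {w : ℝ} (hw : |w| ≤ 2)
    (h0 : w ≠ -1) (h1 : w ≠ 0) (h2 : w ≠ 1) :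
    |sensitivity n k (pt n (4 * (k : ℕ) + 5 / 2 + w))| ≤ 9200 := by
  have hm := mem_of_block k hw
  have hn0 : 0 < n := by omega
  have hL := centerLength_pos k
  have hV := abs_sensitivity_mul hn k w
  have hk : (4 : ℝ) * (k : ℕ) + 5 ≤ n := by exact_mod_cast lt_of_block k
  have hk0 : (0 : ℝ) ≤ (k : ℕ) := by positivity
  have A0 := len_mul_le (v := 4 * (k : ℕ) + 3 / 2) (m := (4 * (k : ℕ) + 3 : ℕ)) hm.1 hm.2
    (by linarith) (by linarith) (by push_cast; norm_num [abs_le])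
  have A1 := len_mul_le (v := 4 * (k : ℕ) + 5 / 2) (m := (4 * (k : ℕ) + 3 : ℕ)) hm.1 hm.2
    (by linarith) (by linarith) (by push_cast; norm_num [abs_le])
  have A2 := len_mul_le (v := 4 * (k : ℕ) + 7 / 2) (m := (4 * (k : ℕ) + 3 : ℕ)) hm.1 hm.2
    (by linarith) (by linarith) (by push_cast; norm_num [abs_le])
  rw [← nodalLength_eq_len] at A0 A1 A2
  rw [show 4 * ((k : ℕ) : ℝ) + 5 / 2 + w - (4 * (k : ℕ) + 3 / 2) = w + 1 by ring] at A0
  rw [show 4 * ((k : ℕ) : ℝ) + 5 / 2 + w - (4 * (k : ℕ) + 5 / 2) = w by ring] at A1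
  rw [show 4 * ((k : ℕ) : ℝ) + 5 / 2 + w - (4 * (k : ℕ) + 7 / 2) = w - 1 by ring] at A2
  have q0 := abs_pt_sub_pos hn0 hm (v := 4 * (k : ℕ) + 3 / 2) ⟨by linarith, by linarith⟩
    (fun h => h0 (by linarith))
  have q1 := abs_pt_sub_pos hn0 hm (v := 4 * (k : ℕ) + 5 / 2) ⟨by linarith, by linarith⟩
    (fun h => h1 (by linarith))
  have q2 := abs_pt_sub_pos hn0 hm (v := 4 * (k : ℕ) + 7 / 2) ⟨by linarith, by linarith⟩
    (fun h => h2 (by linarith))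
  set P := pt n (4 * (k : ℕ) + 5 / 2 + w)
  set L := nodalLength n (4 * (k : ℕ) + 3)
  set a0 := |P - pt n (4 * (k : ℕ) + 3 / 2)|
  set a1 := |P - pt n (4 * (k : ℕ) + 5 / 2)|
  set a2 := |P - pt n (4 * (k : ℕ) + 7 / 2)|
  refine le_of_mul_le_mul_right ?_ (mul_pos (mul_pos q0 q1) q2)
  rw [hV]
  have core : ∀ x y z d : ℝ, 0 < x → 0 < y → 0 < z → |sin (π * w)| ≤ π * d → L * d ≤ 9 * x →
      L ≤ 18 * y → L ≤ 18 * z → L ^ 3 * |sin (π * w)| ≤ 9200 * (x * y * z) := by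
    intro x y z d hx hy hz hs hd hy' hz'
    calc L ^ 3 * |sin (π * w)| ≤ L ^ 3 * (π * d) := by gcongr
      _ = π * (L * d) * L * L := by ring
      _ ≤ π * (9 * x) * (18 * y) * (18 * z) := by
          have := pi_pos
          gcongr
      _ = π * 2916 * (x * y * z) := by ring
      _ ≤ 9200 * (x * y * z) := by
          have := pi_lt_d2
          gcongr
          linarith
  have far : ∀ d x : ℝ, L * d ≤ 9 * x → 1 / 2 ≤ d → L ≤ 18 * x := by
    intro d x h h'
    nlinarith
  by_cases c1 : |w| ≤ 1 / 2
  · have c1' := abs_le.1 c1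
    have := core a1 a0 a2 |w| q1 q0 q2 (abs_sin_pi_mul_le w) A1
      (far _ _ A0 (le_abs.2 (Or.inl (by linarith))))
      (far _ _ A2 (le_abs.2 (Or.inr (by linarith))))
    linarith
  · have c1' := not_le.1 c1
    rcases lt_abs.1 c1' with h | h
    · have := core a2 a0 a1 |w - 1| q2 q0 q1 (by
        have := abs_sin_pi_mul_le (w - 1)
        rwa [show π * (w - 1) = π * w - π by ring, sin_sub_pi, abs_neg] at this) A2
        (far _ _ A0 (le_abs.2 (Or.inl (by linarith)))) (far _ _ A1 c1'.le)
      linarith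
    · have := core a0 a1 a2 |w + 1| q0 q1 q2 (by
        have := abs_sin_pi_mul_le (w + 1)
        rwa [show π * (w + 1) = π * w + π by ring, sin_add_pi, abs_neg] at this) A0
        (far _ _ A1 c1'.le) (far _ _ A2 (le_abs.2 (Or.inr (by linarith))))
      linarith

/-- For equal spacing the value is `|sin (π w)| / (|w| (1 - w ^ 2)) ≥ 3 / (1 + |w|) ≥ 3/2`; the
slack down to `7/5` absorbs three factors `1 - 4 / K`. -/
theorem le_abs_sensitivity {n : ℕ} (hn : n % 4 = 1) (k : Fin (numBlocks n)) {K w : ℝ}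
    (hK : 1000 ≤ K) (hk : K ≤ (k : ℕ)) (hk' : 4 * ((k : ℕ) : ℝ) + 5 + 4 * K ≤ n)
    (hw : |w| ≤ 1) (h0 : w ≠ -1) (h1 : w ≠ 0) (h2 : w ≠ 1) :
    7 / 5 ≤ |sensitivity n k (pt n (4 * (k : ℕ) + 5 / 2 + w))| := by
  have hm := mem_of_block k (w := w) (by linarith)
  have hn0 : 0 < n := by omega
  have hL := centerLength_pos k
  have hV := abs_sensitivity_mul hn k w
  have hw' := abs_le.1 hw
  have A0 := le_len_of_central (n := n) (u := 4 * (k : ℕ) + 5 / 2 + w) (v := 4 * (k : ℕ) + 3 / 2)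
    (m := (4 * (k : ℕ) + 3 : ℕ)) (K := K) (by linarith)
    (by linarith) (by linarith) (by linarith) (by linarith)
    (by push_cast; rw [abs_le]; constructor <;> linarith)
  have A1 := le_len_of_central (n := n) (u := 4 * (k : ℕ) + 5 / 2 + w) (v := 4 * (k : ℕ) + 5 / 2)
    (m := (4 * (k : ℕ) + 3 : ℕ)) (K := K) (by linarith)
    (by linarith) (by linarith) (by linarith) (by linarith)
    (by push_cast; rw [abs_le]; constructor <;> linarith)
  have A2 := le_len_of_central (n := n) (u := 4 * (k : ℕ) + 5 / 2 + w) (v := 4 * (k : ℕ) + 7 / 2)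
    (m := (4 * (k : ℕ) + 3 : ℕ)) (K := K) (by linarith)
    (by linarith) (by linarith) (by linarith) (by linarith)
    (by push_cast; rw [abs_le]; constructor <;> linarith)
  rw [← nodalLength_eq_len] at A0 A1 A2
  rw [show 4 * ((k : ℕ) : ℝ) + 5 / 2 + w - (4 * (k : ℕ) + 3 / 2) = w + 1 by ring] at A0
  rw [show 4 * ((k : ℕ) : ℝ) + 5 / 2 + w - (4 * (k : ℕ) + 5 / 2) = w by ring] at A1
  rw [show 4 * ((k : ℕ) : ℝ) + 5 / 2 + w - (4 * (k : ℕ) + 7 / 2) = w - 1 by ring] at A2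
  have q0 := abs_pt_sub_pos hn0 hm (v := 4 * (k : ℕ) + 3 / 2) ⟨by linarith, by linarith⟩
    (fun h => h0 (by linarith))
  have q1 := abs_pt_sub_pos hn0 hm (v := 4 * (k : ℕ) + 5 / 2) ⟨by linarith, by linarith⟩
    (fun h => h1 (by linarith))
  have q2 := abs_pt_sub_pos hn0 hm (v := 4 * (k : ℕ) + 7 / 2) ⟨by linarith, by linarith⟩
    (fun h => h2 (by linarith))
  set P := pt n (4 * (k : ℕ) + 5 / 2 + w)
  set L := nodalLength n (4 * (k : ℕ) + 3)
  set a0 := |P - pt n (4 * (k : ℕ) + 3 / 2)|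
  set a1 := |P - pt n (4 * (k : ℕ) + 5 / 2)|
  set a2 := |P - pt n (4 * (k : ℕ) + 7 / 2)|
  refine le_of_mul_le_mul_right ?_ (mul_pos (mul_pos q0 q1) q2)
  rw [hV]
  have hκ : (249 : ℝ) / 250 ≤ 1 - 4 / K := by
    have : 4 / K ≤ 4 / 1000 := by gcongr
    linarith
  have hs : 3 * |w| * (1 - |w|) ≤ |sin (π * w)| := by
    have h := three_mul_le_sin (abs_nonneg w) hw
    refine h.trans ?_
    rcases abs_cases w with ⟨e, _⟩ | ⟨e, _⟩
    · rw [e]; exact le_abs_self _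
    · rw [e, show π * -w = -(π * w) by ring, sin_neg]; exact neg_le_abs _
  have hprod : |w + 1| * |w| * |w - 1| ≤ 2 * (|w| * (1 - |w|)) := by
    have e1 : |w + 1| = w + 1 := abs_of_nonneg (by linarith)
    have e2 : |w - 1| = 1 - w := by rw [abs_of_nonpos (by linarith)]; ring
    have e3 : |w + 1| * |w| * |w - 1| = (1 + |w|) * (|w| * (1 - |w|)) := by
      rw [e1, e2]
      have := sq_abs w
      linear_combination |w| * this
    rw [e3]
    have : 0 ≤ |w| * (1 - |w|) := mul_nonneg (abs_nonneg _) (by linarith)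
    gcongr
    linarith
  have hmul : (249 / 250) ^ 3 * (a0 * a1 * a2) ≤ L ^ 3 * (|w + 1| * |w| * |w - 1|) := by
    have b0 : 249 / 250 * a0 ≤ L * |w + 1| := le_trans (by gcongr) A0
    have b1 : 249 / 250 * a1 ≤ L * |w| := le_trans (by gcongr) A1
    have b2 : 249 / 250 * a2 ≤ L * |w - 1| := le_trans (by gcongr) A2
    calc (249 / 250) ^ 3 * (a0 * a1 * a2) = (249 / 250 * a0) * (249 / 250 * a1) * (249 / 250 * a2) := by
          ring
      _ ≤ (L * |w + 1|) * (L * |w|) * (L * |w - 1|) := by gcongr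
      _ = _ := by ring
  have hL3 : 0 < L ^ 3 := by positivity
  have h5 : L ^ 3 * (|w + 1| * |w| * |w - 1|) ≤ L ^ 3 * (2 / 3 * |sin (π * w)|) :=
    mul_le_mul_of_nonneg_left (by linarith) hL3.le
  have h6 : 0 < a0 * a1 * a2 := mul_pos (mul_pos q0 q1) q2
  nlinarith

/-! ### Effect of one block on the points of another -/

/-- Multiplying out the three sharp bounds would leave an error of order `η ^ 3`, not summable over
the blocks. Replacing factors one at a time, with the crude bound `9 / g` for those still untouched,
gives the decaying error `(81 + 9 + 1) η / g ^ 2`. -/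
theorem mul_three_le {l0 l1 l2 d0 d1 d2 A0 A1 A2 g η : ℝ} (hη : 0 ≤ η) (hg : 0 < g)
    (hl0 : 0 ≤ l0) (hl1 : 0 ≤ l1) (hl2 : 0 ≤ l2)
    (hd0 : g ≤ d0) (hd1 : g ≤ d1) (hd2 : g ≤ d2) (hA0 : 0 < A0) (hA1 : 0 < A1) (hA2 : 0 < A2)
    (h0 : l0 ≤ (1 / d0 + η) * A0) (h1 : l1 ≤ (1 / d1 + η) * A1) (h2 : l2 ≤ (1 / d2 + η) * A2)
    (h1' : l1 * d1 ≤ 9 * A1) (h2' : l2 * d2 ≤ 9 * A2) :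
    l0 * l1 * l2 ≤ (1 / (d0 * d1 * d2) + 91 * η / g ^ 2) * (A0 * A1 * A2) := by
  have hd0' : 0 < d0 := by linarith
  have hd1' : 0 < d1 := by linarith
  have hd2' : 0 < d2 := by linarith
  obtain ⟨q0, rfl⟩ : ∃ q, l0 = q * A0 := ⟨l0 / A0, by field_simp⟩
  obtain ⟨q1, rfl⟩ : ∃ q, l1 = q * A1 := ⟨l1 / A1, by field_simp⟩
  obtain ⟨q2, rfl⟩ : ∃ q, l2 = q * A2 := ⟨l2 / A2, by field_simp⟩
  replace h0 := le_of_mul_le_mul_right h0 hA0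
  replace h1 := le_of_mul_le_mul_right h1 hA1
  replace h2 := le_of_mul_le_mul_right h2 hA2
  replace hl0 := nonneg_of_mul_nonneg_left hl0 hA0
  replace hl1 := nonneg_of_mul_nonneg_left hl1 hA1
  replace hl2 := nonneg_of_mul_nonneg_left hl2 hA2
  have k1 : q1 ≤ 9 * (1 / g) := by
    have : q1 * d1 ≤ 9 := le_of_mul_le_mul_right (by linarith) hA1
    have : q1 * g ≤ 9 := le_trans (by gcongr) this
    rw [mul_one_div, le_div_iff₀ hg]; exact this
  have k2 : q2 ≤ 9 * (1 / g) := by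
    have : q2 * d2 ≤ 9 := le_of_mul_le_mul_right (by linarith) hA2
    have : q2 * g ≤ 9 := le_trans (by gcongr) this
    rw [mul_one_div, le_div_iff₀ hg]; exact this
  have p0 : 1 / d0 ≤ 1 / g := by gcongr
  have p1 : 1 / d1 ≤ 1 / g := by gcongr
  have e : (1 / (d0 * d1 * d2) + 91 * η / g ^ 2) =
      1 / d0 * (1 / d1) * (1 / d2) + 91 * η * (1 / g) ^ 2 := by
    field_simp
  rw [e]
  have hp0 : 0 < 1 / d0 := by positivity
  have hp1 : 0 < 1 / d1 := by positivity
  have hp2 : 0 < 1 / d2 := by positivity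
  have hγ : 0 < 1 / g := by positivity
  generalize 1 / d0 = p at *
  generalize 1 / d1 = q at *
  generalize 1 / d2 = r at *
  generalize 1 / g = γ at *
  have s1 : q0 * q1 * q2 ≤ (p + η) * q1 * q2 := by gcongr
  have s2 : η * q1 * q2 ≤ η * (9 * γ) * (9 * γ) := by gcongr
  have s3 : p * q1 * q2 ≤ p * (q + η) * q2 := by gcongr
  have s4 : p * η * q2 ≤ γ * η * (9 * γ) := by gcongr
  have s5 : p * q * q2 ≤ p * q * (r + η) := by gcongr
  have s6 : p * q * η ≤ γ * γ * η := by gcongr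
  calc q0 * A0 * (q1 * A1) * (q2 * A2) = (q0 * q1 * q2) * (A0 * A1 * A2) := by ring
    _ ≤ _ := by
      gcongr
      linarith

/-- The relative effect of a perturbation of the block `j` at a central point outside of it. -/
theorem block_effect {n : ℕ} (j : Fin (numBlocks n)) {K u : ℝ} (hK : 0 < K) (hu : 4 * K ≤ u)
    (hu' : u ≤ n - 4 * K) (hd : 2 ≤ |u - (4 * (j : ℕ) + 5 / 2)|) :
    blockCubic n j (pt n u) ≠ 0 ∧
    (1 + blockRatio n j) * nodalLength n (4 * (j : ℕ) + 3) ^ 3 ≤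
      (2 / (|u - (4 * (j : ℕ) + 5 / 2)| * (|u - (4 * (j : ℕ) + 5 / 2)| ^ 2 - 1)) +
        364 / K / (|u - (4 * (j : ℕ) + 5 / 2)| - 1) ^ 2) * |blockCubic n j (pt n u)| := by
  have hj : (4 : ℝ) * (j : ℕ) + 5 ≤ n := by exact_mod_cast lt_of_block j
  have hj0 : (0 : ℝ) ≤ (j : ℕ) := by positivity
  have hn : (0 : ℝ) < n := by linarith
  have hn0 : 0 < n := by exact_mod_cast hn
  obtain ⟨w, rfl⟩ : ∃ w, u = 4 * (j : ℕ) + 5 / 2 + w := ⟨u - (4 * (j : ℕ) + 5 / 2), by ring⟩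
  have e0 : 4 * ((j : ℕ) : ℝ) + 5 / 2 + w - (4 * (j : ℕ) + 3 / 2) = w + 1 := by ring
  have e1 : 4 * ((j : ℕ) : ℝ) + 5 / 2 + w - (4 * (j : ℕ) + 5 / 2) = w := by ring
  have e2 : 4 * ((j : ℕ) : ℝ) + 5 / 2 + w - (4 * (j : ℕ) + 7 / 2) = w - 1 := by ring
  rw [e1] at hd ⊢
  have g0 : |w| - 1 ≤ |w + 1| := by
    have := abs_sub_abs_le_abs_sub w (-1)
    rwa [abs_neg, abs_one, sub_neg_eq_add] at this
  have g2 : |w| - 1 ≤ |w - 1| := by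
    have := abs_sub_abs_le_abs_sub w 1
    rwa [abs_one] at this
  have ep : |w + 1| * |w - 1| * |w| = |w| * (|w| ^ 2 - 1) := by
    rw [← abs_mul, show (w + 1) * (w - 1) = w ^ 2 - 1 by ring, sq_abs, abs_of_nonneg, mul_comm]
    rw [← sq_abs]; nlinarith
  have hu0 : 4 * ((j : ℕ) : ℝ) + 5 / 2 + w ∈ Set.Icc (0 : ℝ) n := ⟨by linarith, by linarith⟩
  have fine : ∀ v m : ℝ, 3 / 2 ≤ v → v ≤ n - 3 / 2 → |m - v| ≤ 3 / 2 →
      1 ≤ |4 * ((j : ℕ) : ℝ) + 5 / 2 + w - v| → _ := fun v m h1 h2 h3 h4 =>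
    And.intro (len_le_of_central (n := n) (m := m) hK hu hu' (by linarith) (by linarith) h3 h4)
      (len_mul_le (n := n) (m := m) hu0.1 hu0.2 h1 h2 h3)
  have A0 := fine (4 * (j : ℕ) + 3 / 2) (4 * (j : ℕ) + 3 : ℕ) (by linarith) (by linarith)
    (by push_cast; norm_num [abs_le]) (by rw [e0]; linarith)
  have A2 := fine (4 * (j : ℕ) + 7 / 2) (4 * (j : ℕ) + 3 : ℕ) (by linarith) (by linarith)
    (by push_cast; norm_num [abs_le]) (by rw [e2]; linarith)
  have A1 := fine (4 * (j : ℕ) + 5 / 2) (4 * (j : ℕ) + 3 : ℕ) (by linarith) (by linarith)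
    (by push_cast; norm_num [abs_le]) (by rw [e1]; linarith)
  have B1 := fine (4 * (j : ℕ) + 5 / 2) (4 * (j : ℕ) + 2 : ℕ) (by linarith) (by linarith)
    (by push_cast; norm_num [abs_le]) (by rw [e1]; linarith)
  rw [← nodalLength_eq_len] at A0 A1 A2 B1
  rw [e0] at A0
  rw [e1] at A1 B1
  rw [e2] at A2
  have q0 := abs_pt_sub_pos hn0 hu0 (v := 4 * (j : ℕ) + 3 / 2) ⟨by linarith, by linarith⟩
    (fun h => by rw [show w = -1 by linarith] at hd; norm_num at hd)
  have q1 := abs_pt_sub_pos hn0 hu0 (v := 4 * (j : ℕ) + 5 / 2) ⟨by linarith, by linarith⟩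
    (fun h => by rw [show w = 0 by linarith] at hd; norm_num at hd)
  have q2 := abs_pt_sub_pos hn0 hu0 (v := 4 * (j : ℕ) + 7 / 2) ⟨by linarith, by linarith⟩
    (fun h => by rw [show w = 1 by linarith] at hd; norm_num at hd)
  have hL := centerLength_pos j
  have hL' : 0 < nodalLength n (4 * (j : ℕ) + 2) :=
    nodalLength_pos (by omega) (by have := lt_of_block j; omega)
  have hη : 0 ≤ 2 / K := by positivity
  have hU : |blockCubic n j (pt n (4 * (j : ℕ) + 5 / 2 + w))| =
      |pt n (4 * (j : ℕ) + 5 / 2 + w) - pt n (4 * (j : ℕ) + 3 / 2)| *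
        |pt n (4 * (j : ℕ) + 5 / 2 + w) - pt n (4 * (j : ℕ) + 7 / 2)| *
        |pt n (4 * (j : ℕ) + 5 / 2 + w) - pt n (4 * (j : ℕ) + 5 / 2)| := by
    rw [blockCubic_pt, abs_mul, abs_mul]; ring
  -- `(1 + a) * L ^ 3` is the sum of `L * L * L` and `L * L * L'`, where `L'` is the left middle
  -- length; each is estimated separately with `η = 2 / K`, whence `364 = 2 * 91 * 2`.
  have M1 := mul_three_le hη (by linarith : 0 < |w| - 1) hL.le hL.le hL.le g0 g2 (by linarith)
    q0 q2 q1 A0.1 A2.1 A1.1 A2.2 A1.2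
  have M2 := mul_three_le hη (by linarith : 0 < |w| - 1) hL.le hL.le hL'.le g0 g2 (by linarith)
    q0 q2 q1 A0.1 A2.1 B1.1 A2.2 B1.2
  rw [← hU, ep] at M1 M2
  constructor
  · rw [← abs_pos, hU]; positivity
  · rw [← blockRatio_mul] at M2
    have e : 2 / (|w| * (|w| ^ 2 - 1)) + 364 / K / (|w| - 1) ^ 2 =
        2 * (1 / (|w| * (|w| ^ 2 - 1)) + 91 * (2 / K) / (|w| - 1) ^ 2) := by ring
    rw [e]
    linarith

/-! ### Averages over a block: offset and gain -/

theorem root_left_end (n k : ℕ) : root n (4 * k + 1) = pt n (4 * (k : ℝ) + 5 / 2 + -2) := by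
  rw [root_eq_pt]; push_cast; ring_nf

theorem root_right_end (n k : ℕ) : root n (4 * k + 5) = pt n (4 * (k : ℝ) + 5 / 2 + 2) := by
  rw [root_eq_pt]; push_cast; ring_nf

theorem root_left (n k : ℕ) : root n (4 * k + 2) = pt n (4 * (k : ℝ) + 5 / 2 + -1) := by
  rw [root_eq_pt]; push_cast; ring_nf

theorem root_center (n k : ℕ) : root n (4 * k + 3) = pt n (4 * (k : ℝ) + 5 / 2 + 0) := by
  rw [root_eq_pt]; push_cast; ring_nf

theorem root_right (n k : ℕ) : root n (4 * k + 4) = pt n (4 * (k : ℝ) + 5 / 2 + 1) := by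
  rw [root_eq_pt]; push_cast; ring_nf

theorem ae_ne_interior_roots (n k : ℕ) :
    ∀ᵐ x : ℝ, x ≠ root n (4 * k + 2) ∧ x ≠ root n (4 * k + 3) ∧ x ≠ root n (4 * k + 4) := by
  have h : ({root n (4 * k + 2), root n (4 * k + 3), root n (4 * k + 4)} : Set ℝ).Finite :=
    Set.toFinite _
  filter_upwards [h.countable.ae_notMem volume] with x hx
  simpa using hx

theorem exists_offset {n k : ℕ} {x : ℝ} {α β : ℝ} (hαβ : α ≤ β)
    (hx : x ∈ Set.Icc (pt n (4 * (k : ℝ) + 5 / 2 + α)) (pt n (4 * (k : ℝ) + 5 / 2 + β)))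
    (h : x ≠ root n (4 * k + 2) ∧ x ≠ root n (4 * k + 3) ∧ x ≠ root n (4 * k + 4)) :
    ∃ w, α ≤ w ∧ w ≤ β ∧ w ≠ -1 ∧ w ≠ 0 ∧ w ≠ 1 ∧ x = pt n (4 * (k : ℝ) + 5 / 2 + w) := by
  obtain ⟨u, hu, rfl⟩ := exists_index n (by linarith) hx
  obtain ⟨w, rfl⟩ : ∃ w, u = 4 * (k : ℝ) + 5 / 2 + w := ⟨u - (4 * (k : ℝ) + 5 / 2), by ring⟩
  rw [root_left, root_center, root_right] at h
  refine ⟨w, by linarith [hu.1], by linarith [hu.2], ?_, ?_, ?_, rfl⟩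
  · rintro rfl; exact h.1 rfl
  · rintro rfl; exact h.2.1 rfl
  · rintro rfl; exact h.2.2 rfl

theorem continuous_cofactor (n : ℕ) (k : Fin (numBlocks n)) : Continuous (cofactor n k) := by
  unfold cofactor blockCubic
  fun_prop

theorem continuous_blockCubic (n k : ℕ) : Continuous (blockCubic n k) := by
  unfold blockCubic
  fun_prop

theorem continuous_sensitivity (n : ℕ) (k : Fin (numBlocks n)) : Continuous (sensitivity n k) := by
  have := continuous_cofactor n k
  unfold sensitivity
  fun_prop

theorem continuous_perturbedT (n : ℕ) (y : Fin (numBlocks n) → ℝ) :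
    Continuous (perturbedT n y) := by
  unfold perturbedT
  fun_prop

theorem block_width_pos {n : ℕ} (k : Fin (numBlocks n)) :
    0 < root n (4 * (k : ℕ) + 5) - root n (4 * (k : ℕ) + 1) := by
  have h := lt_of_block k
  rw [root_left_end, root_right_end, sub_pos]
  exact pt_strictMonoOn (by omega) (mem_of_block k (by norm_num)) (mem_of_block k (by norm_num))
    (by linarith)

/-- The average of the sensitivity over the block. -/
noncomputable def gain (n : ℕ) (k : Fin (numBlocks n)) : ℝ :=
  (1 / (root n (4 * (k : ℕ) + 5) - root n (4 * (k : ℕ) + 1))) *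
    ∫ x in (root n (4 * (k : ℕ) + 1))..(root n (4 * (k : ℕ) + 5)), sensitivity n k x

/-- The average of the Chebyshev polynomial over the block. -/
noncomputable def offset (n : ℕ) (k : Fin (numBlocks n)) : ℝ :=
  (1 / (root n (4 * (k : ℕ) + 5) - root n (4 * (k : ℕ) + 1))) *
    ∫ x in (root n (4 * (k : ℕ) + 1))..(root n (4 * (k : ℕ) + 5)),
      cofactor n k x * blockCubic n k x

theorem perturbedT_single_eq {n : ℕ} (k : Fin (numBlocks n)) {s : ℝ}
    (hs : 0 ≤ deltaDisc s (blockRatio n k)) (x : ℝ) :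
    perturbedT n (Pi.single k s) x = cofactor n k x * blockCubic n k x +
      shift s (blockRatio n k) * sensitivity n k x := by
  rw [perturbedT_single k hs, sensitivity]; ring

theorem blockAverage_single {n : ℕ} (k : Fin (numBlocks n)) {s : ℝ}
    (hs : 0 ≤ deltaDisc s (blockRatio n k)) :
    blockAverage n k (Pi.single k s) = offset n k + shift s (blockRatio n k) * gain n k := by
  unfold blockAverage offset gain
  simp_rw [perturbedT_single_eq k hs]
  have h1 := continuous_cofactor n k
  have h2 := continuous_blockCubic n k
  have h3 := continuous_sensitivity n k
  rw [intervalIntegral.integral_add, intervalIntegral.integral_const_mul]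
  · ring
  · exact Continuous.intervalIntegrable (by fun_prop) _ _
  · exact Continuous.intervalIntegrable (by fun_prop) _ _

theorem hasDerivAt_pt (n : ℕ) (u : ℝ) : HasDerivAt (pt n) (π / n * sin (π * u / n)) u := by
  have h : HasDerivAt (fun u : ℝ => π * u / n) (π / n) u := by
    simpa using ((hasDerivAt_id u).const_mul π).div_const (n : ℝ)
  exact h.cos.neg.congr_deriv (by ring)

theorem abs_integral_le {n : ℕ} (hn : n % 4 = 1) (k : Fin (numBlocks n)) :
    |∫ x in (root n (4 * (k : ℕ) + 1))..(root n (4 * (k : ℕ) + 5)),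
      cofactor n k x * blockCubic n k x| ≤ 80 / n ^ 2 := by
  have hn0 : (0 : ℝ) < n := by norm_cast; omega
  have h1 := continuous_cofactor n k
  have h2 := continuous_blockCubic n k
  set c : ℝ := 4 * (k : ℕ) + 5 / 2 with hc
  rw [root_left_end, root_right_end, ← hc, ← intervalIntegral.integral_comp_mul_deriv
    (f := pt n) (fun u _ => hasDerivAt_pt n u) (by fun_prop) (by fun_prop)]
  -- A block spans two full periods of `cos (π u)`, so the density `sin (π u / n)` may be replaced
  -- by its deviation from the value at the center, which is `O(1 / n)`.
  have hz : ∫ u in (c + -2)..(c + 2), cos (π * u) = 0 := by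
    rw [intervalIntegral.integral_comp_mul_left (f := cos) pi_pos.ne', integral_cos,
      show π * (c + 2) = π * (c + -2) + 2 * π + 2 * π by ring, sin_add_two_pi, sin_add_two_pi]
    simp
  have e : ∫ u in (c + -2)..(c + 2),
      ((fun x => cofactor n k x * blockCubic n k x) ∘ pt n) u * (π / n * sin (π * u / n)) =
      ∫ u in (c + -2)..(c + 2),
        -(π / n * (cos (π * u) * (sin (π * u / n) - sin (π * c / n)))) := by
    have e1 : ∫ u in (c + -2)..(c + 2),
        -(π / n * (cos (π * u) * (sin (π * u / n) - sin (π * c / n)))) =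
        (∫ u in (c + -2)..(c + 2), -(π / n * (cos (π * u) * sin (π * u / n)))) +
        ∫ u in (c + -2)..(c + 2), (π / n * sin (π * c / n)) * cos (π * u) := by
      rw [← intervalIntegral.integral_add]
      · congr 1; ext u; ring
      · exact Continuous.intervalIntegrable (by fun_prop) _ _
      · exact Continuous.intervalIntegrable (by fun_prop) _ _
    rw [e1, intervalIntegral.integral_const_mul, hz, mul_zero, add_zero]
    congr 1
    ext u
    simp only [Function.comp]
    rw [cofactor_mul_blockCubic hn]
    ring
  rw [e]
  have hb := intervalIntegral.norm_integral_le_of_norm_le_const (a := c + -2) (b := c + 2)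
    (f := fun u => -(π / n * (cos (π * u) * (sin (π * u / n) - sin (π * c / n)))))
    (C := 20 / n ^ 2) (by
      intro u hu
      rw [Set.uIoc_of_le (by linarith)] at hu
      have hπ := pi_pos
      rw [norm_neg, norm_mul, norm_mul, norm_eq_abs, norm_eq_abs, norm_eq_abs,
        abs_of_pos (by positivity : 0 < π / (n : ℝ))]
      have hd : |u - c| ≤ 2 := abs_le.2 ⟨by linarith [hu.1], by linarith [hu.2]⟩
      calc π / n * (|cos (π * u)| * |sin (π * u / n) - sin (π * c / n)|)
          ≤ π / n * (1 * (π * |u - c| / n)) := by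
            gcongr
            · exact abs_cos_le_one _
            · exact abs_sin_index_sub_le n u c
        _ ≤ π / n * (1 * (π * 2 / n)) := by gcongr
        _ = (2 * π ^ 2) / n ^ 2 := by ring
        _ ≤ 20 / n ^ 2 := by
          gcongr
          have := pi_lt_d2
          nlinarith)
  rw [norm_eq_abs] at hb
  refine hb.trans (le_of_eq ?_)
  rw [show c + 2 - (c + -2) = 4 by ring]
  norm_num
  ring

theorem abs_offset_le {n : ℕ} (hn : n % 4 = 1) (k : Fin (numBlocks n)) {K : ℝ} (hK : 0 < K)
    (hk : K ≤ (k : ℕ)) (hk' : 4 * ((k : ℕ) : ℝ) + 5 + 4 * K ≤ n) : |offset n k| ≤ 2 / K := by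
  have hn0 : (0 : ℝ) < n := by norm_cast; omega
  have hI := abs_integral_le hn k
  have hW : 64 * K / n ^ 2 ≤ root n (4 * (k : ℕ) + 5) - root n (4 * (k : ℕ) + 1) := by
    rw [root_left_end, root_right_end, pt_sub_pt]
    have h1 := sin_ge_of_index (n := n) (M := 4 * K) (s := 4 * (k : ℕ) + 5 / 2)
      (by positivity) (by linarith) (by linarith)
    have h2 := sin_ge_of_index (n := n) (M := 2) (s := 2) (by positivity) le_rfl (by linarith)
    rw [show (4 * ((k : ℕ) : ℝ) + 5 / 2 + 2 + (4 * (k : ℕ) + 5 / 2 + -2)) / 2 =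
      4 * (k : ℕ) + 5 / 2 by ring, show (4 * ((k : ℕ) : ℝ) + 5 / 2 + 2 -
      (4 * (k : ℕ) + 5 / 2 + -2)) / 2 = 2 by ring]
    calc 64 * K / (n : ℝ) ^ 2 = 2 * (2 * (4 * K) / n) * (2 * 2 / n) := by field_simp; norm_num
      _ ≤ _ := by
        have : 0 ≤ sin (π * (4 * (k : ℕ) + 5 / 2) / n) := le_trans (by positivity) h1
        gcongr
  have hp := block_width_pos k
  unfold offset
  rw [abs_mul, abs_of_pos (by positivity)]
  rw [one_div, inv_mul_le_iff₀ hp]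
  refine hI.trans ?_
  calc 80 / (n : ℝ) ^ 2 ≤ 64 * K / n ^ 2 * (2 / K) := by
        rw [show 64 * K / (n : ℝ) ^ 2 * (2 / K) = 128 / n ^ 2 by field_simp; norm_num]
        gcongr
        norm_num
    _ ≤ _ := by gcongr

/-- The sensitivity is at least `7/5` between the outer interior roots, a stretch of length `(1 + a)
* L`, and nonnegative elsewhere. Since the block has length about `4 * L` and `a` is about `1`, the
result is close to `7/5 * (1 + a) ^ 2 / 4`. -/
theorem le_gain {n : ℕ} (hn : n % 4 = 1) (k : Fin (numBlocks n)) {K : ℝ} (hK : 1000 ≤ K)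
    (hk : K ≤ (k : ℕ)) (hk' : 4 * ((k : ℕ) : ℝ) + 5 + 4 * K ≤ n) :
    13 / 10 ≤ (1 + blockRatio n k) * gain n k := by
  have hn0 : 0 < n := by omega
  have hV := continuous_sensitivity n k
  have mono := fun α β : ℝ => pt_strictMonoOn hn0 |>.monotoneOn (a := 4 * (k : ℕ) + 5 / 2 + α)
    (b := 4 * (k : ℕ) + 5 / 2 + β)
  have m1 := mono (-2) (-1) (mem_of_block k (by norm_num)) (mem_of_block k (by norm_num)) (by linarith)
  have m2 := mono (-1) 1 (mem_of_block k (by norm_num)) (mem_of_block k (by norm_num)) (by linarith)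
  have m3 := mono 1 2 (mem_of_block k (by norm_num)) (mem_of_block k (by norm_num)) (by linarith)
  have outer : ∀ α β : ℝ, -2 ≤ α → β ≤ 2 → α ≤ β →
      pt n (4 * (k : ℕ) + 5 / 2 + α) ≤ pt n (4 * (k : ℕ) + 5 / 2 + β) →
      0 ≤ ∫ x in (pt n (4 * (k : ℕ) + 5 / 2 + α))..(pt n (4 * (k : ℕ) + 5 / 2 + β)),
        sensitivity n k x := by
    intro α β hα hβ hαβ hle
    refine intervalIntegral.integral_nonneg_of_ae_restrict hle ?_
    rw [Filter.EventuallyLE, ae_restrict_iff' measurableSet_Icc]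
    filter_upwards [ae_ne_interior_roots n k] with x hx hmem
    obtain ⟨w, h1, h2, h3, h4, h5, rfl⟩ := exists_offset hαβ hmem hx
    exact sensitivity_nonneg hn k (abs_le.2 ⟨by linarith, by linarith⟩) h3 h4 h5
  have inner : 7 / 5 * (pt n (4 * (k : ℕ) + 5 / 2 + 1) - pt n (4 * (k : ℕ) + 5 / 2 + -1)) ≤
      ∫ x in (pt n (4 * (k : ℕ) + 5 / 2 + -1))..(pt n (4 * (k : ℕ) + 5 / 2 + 1)),
        sensitivity n k x := by
    have := intervalIntegral.integral_mono_ae_restrict (f := fun _ => (7 / 5 : ℝ))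
      (g := sensitivity n k) (μ := volume) m2 (by simp) (hV.intervalIntegrable _ _) (by
        rw [Filter.EventuallyLE, ae_restrict_iff' measurableSet_Icc]
        filter_upwards [ae_ne_interior_roots n k] with x hx hmem
        obtain ⟨w, h1, h2, h3, h4, h5, rfl⟩ := exists_offset (by norm_num) hmem hx
        have := le_abs_sensitivity hn k hK hk hk' (abs_le.2 ⟨h1, h2⟩) h3 h4 h5
        rwa [abs_of_nonneg
          (sensitivity_nonneg hn k (abs_le.2 ⟨by linarith, by linarith⟩) h3 h4 h5)] at this)
    rw [intervalIntegral.integral_const, smul_eq_mul] at this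
    linarith
  have hsum : 7 / 5 * (pt n (4 * (k : ℕ) + 5 / 2 + 1) - pt n (4 * (k : ℕ) + 5 / 2 + -1)) ≤
      ∫ x in (root n (4 * (k : ℕ) + 1))..(root n (4 * (k : ℕ) + 5)), sensitivity n k x := by
    rw [root_left_end, root_right_end, ← intervalIntegral.integral_add_adjacent_intervals
      (hV.intervalIntegrable _ (pt n (4 * (k : ℕ) + 5 / 2 + 1))) (hV.intervalIntegrable _ _),
      ← intervalIntegral.integral_add_adjacent_intervals
      (hV.intervalIntegrable _ (pt n (4 * (k : ℕ) + 5 / 2 + -1))) (hV.intervalIntegrable _ _)]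
    have o1 := outer (-2) (-1) le_rfl (by norm_num) (by norm_num) m1
    have o2 := outer 1 2 (by norm_num) le_rfl (by norm_num) m3
    linarith
  have hL := centerLength_pos k
  have hκ : (249 : ℝ) / 250 ≤ 1 - 4 / K := by
    have : 4 / K ≤ 4 / 1000 := by gcongr
    linarith
  have hp := block_width_pos k
  have hW : root n (4 * (k : ℕ) + 5) - root n (4 * (k : ℕ) + 1) ≤
      1000 / 249 * nodalLength n (4 * (k : ℕ) + 3) := by
    have h := le_len_of_central (n := n) (u := 4 * (k : ℕ) + 5 / 2 + 2)
      (v := 4 * (k : ℕ) + 5 / 2 + -2) (m := (4 * (k : ℕ) + 3 : ℕ)) (K := K) (by linarith)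
      (by linarith) (by linarith) (by linarith) (by linarith)
      (by push_cast; rw [abs_le]; constructor <;> linarith)
    rw [← nodalLength_eq_len, ← root_left_end, ← root_right_end, abs_of_pos hp,
      show 4 * ((k : ℕ) : ℝ) + 5 / 2 + 2 - (4 * (k : ℕ) + 5 / 2 + -2) = 4 by ring,
      abs_of_pos four_pos] at h
    nlinarith
  have ha : 249 / 250 ≤ blockRatio n k := by
    have h := le_len_of_central (n := n) (u := 4 * (k : ℕ) + 5 / 2 + 1)
      (v := 4 * (k : ℕ) + 5 / 2 + 0) (m := (4 * (k : ℕ) + 2 : ℕ)) (K := K) (by linarith)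
      (by linarith) (by linarith) (by linarith) (by linarith)
      (by push_cast; rw [abs_le]; constructor <;> linarith)
    rw [← nodalLength_eq_len, ← root_right, ← root_center,
      show root n (4 * (k : ℕ) + 4) - root n (4 * (k : ℕ) + 3) = nodalLength n (4 * (k : ℕ) + 3)
        from rfl, abs_of_pos hL, ← blockRatio_mul,
      show 4 * ((k : ℕ) : ℝ) + 5 / 2 + 1 - (4 * (k : ℕ) + 5 / 2 + 0) = 1 by ring, abs_one,
      mul_one] at h
    have := le_of_mul_le_mul_right h hL
    linarith
  have hr : pt n (4 * (k : ℕ) + 5 / 2 + 1) - pt n (4 * (k : ℕ) + 5 / 2 + -1) =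
      (1 + blockRatio n k) * nodalLength n (4 * (k : ℕ) + 3) := by
    rw [add_mul, blockRatio_mul, ← root_right, ← root_left, nodalLength, nodalLength]
    ring
  rw [hr] at hsum
  unfold gain
  rw [one_div, mul_left_comm, le_inv_mul_iff₀ hp]
  set a := blockRatio n k
  set L := nodalLength n (4 * (k : ℕ) + 3)
  calc (root n (4 * (k : ℕ) + 5) - root n (4 * (k : ℕ) + 1)) * (13 / 10)
      ≤ 1000 / 249 * L * (13 / 10) := by gcongr
    _ ≤ 7 / 5 * (499 / 250) ^ 2 * L := by nlinarith
    _ ≤ 7 / 5 * (1 + a) ^ 2 * L := by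
        gcongr
        linarith
    _ = (1 + a) * (7 / 5 * ((1 + a) * L)) := by ring
    _ ≤ _ := by gcongr

/-! ### Summation over the other blocks -/

/-- Bound for the relative effect of a block at distance at least `2 e`. -/
noncomputable def effectBound (K : ℝ) (e : ℕ) : ℝ :=
  2 / (2 * e * ((2 * e) ^ 2 - 1)) + 364 / K / (2 * e - 1) ^ 2

theorem effectBound_nonneg {K : ℝ} (hK : 0 < K) (e : ℕ) : 0 ≤ effectBound K (e + 1) := by
  unfold effectBound
  have h : (1 : ℝ) ≤ (e + 1 : ℕ) := by push_cast; linarith [(Nat.cast_nonneg e : (0 : ℝ) ≤ e)]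
  have : 0 ≤ (2 * ((e + 1 : ℕ) : ℝ)) ^ 2 - 1 := by nlinarith
  positivity

theorem sum_effectBound_le {K : ℝ} (hK : 0 < K) (M : ℕ) :
    ∑ e ∈ Finset.range M, effectBound K (e + 1) ≤ 2 / 5 + 728 / K := by
  -- The subtracted remainders make the induction telescope. The first term `1/3` is kept exactly
  -- and fits because `1/3 ≤ 2/5 - 1/16`.
  suffices h : ∑ e ∈ Finset.range (M + 1), effectBound K (e + 1) ≤
      2 / 5 - 1 / (8 * (M + 1) * (M + 2)) + 364 / K * (2 - 1 / (M + 1)) by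
    refine (Finset.sum_le_sum_of_subset_of_nonneg (Finset.range_mono (Nat.le_succ M))
      fun e _ _ => effectBound_nonneg hK e).trans (h.trans ?_)
    have h1 : (0 : ℝ) ≤ 1 / (8 * (M + 1) * (M + 2)) := by positivity
    have h2 : (0 : ℝ) ≤ 364 / K * (1 / (M + 1)) := by positivity
    have e : 728 / K = 364 / K * 2 := by ring
    rw [e]
    linarith
  induction M with
  | zero =>
    have : 0 ≤ 364 / K := by positivity
    norm_num [effectBound]
  | succ M ih =>
    rw [Finset.sum_range_succ]
    have hM : (0 : ℝ) ≤ M := Nat.cast_nonneg M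
    have h1 : 2 / (2 * ((M : ℝ) + 2) * ((2 * (M + 2)) ^ 2 - 1)) ≤
        1 / (8 * (M + 1) * (M + 2)) - 1 / (8 * (M + 2) * (M + 3)) := by
      have e : 1 / (8 * ((M : ℝ) + 1) * (M + 2)) - 1 / (8 * (M + 2) * (M + 3)) =
          2 / (8 * (M + 1) * (M + 2) * (M + 3)) := by
        field_simp
        ring
      rw [e]
      refine div_le_div_of_nonneg_left (by norm_num) (by positivity) ?_
      nlinarith
    have h2 : 1 / (2 * ((M : ℝ) + 2) - 1) ^ 2 ≤ 1 / (M + 1) - 1 / (M + 2) := by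
      have e : 1 / ((M : ℝ) + 1) - 1 / (M + 2) = 1 / ((M + 1) * (M + 2)) := by
        field_simp
        ring
      rw [e]
      refine one_div_le_one_div_of_le (by positivity) ?_
      nlinarith
    have h3 : 364 / K * (1 / (2 * ((M : ℝ) + 2) - 1) ^ 2) ≤
        364 / K * (1 / (M + 1) - 1 / (M + 2)) := by gcongr
    unfold effectBound at ih ⊢
    push_cast at ih ⊢
    have e1 : (M : ℝ) + 1 + 1 = M + 2 := by ring
    have e2 : (M : ℝ) + 1 + 2 = M + 3 := by ring
    rw [e1, e2]
    rw [div_eq_mul_one_div (364 / K) ((2 * ((M : ℝ) + 2) - 1) ^ 2)]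
    linarith

/-- Twice `ringIndex` bounds from below the distance of the block `j` from a point of the block
`k`; the flag tells in which half of the block the point lies. -/
def ringIndex (right : Bool) (k j : ℕ) : ℕ :=
  if k < j then 2 * (j - k) - (if right then 1 else 0)
  else 2 * (k - j) - (if right then 0 else 1)

theorem exists_ringIndex (k : ℕ) {w : ℝ} (hw : |w| ≤ 2) :
    ∃ b : Bool, ∀ j : ℕ, j ≠ k →
      2 * (ringIndex b k j : ℝ) ≤ |4 * (k : ℝ) + 5 / 2 + w - (4 * (j : ℝ) + 5 / 2)| := by
  have hw' := abs_le.1 hw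
  rcases le_total 0 w with h | h
  · refine ⟨true, fun j hj => ?_⟩
    rcases lt_or_gt_of_ne hj with c | c
    · obtain ⟨d, rfl⟩ := Nat.exists_eq_add_of_lt c
      rw [show ringIndex true (j + d + 1) j = 2 * d + 2 by
        simp only [ringIndex]; split_ifs <;> simp_all <;> omega]
      push_cast
      exact le_abs.2 (Or.inl (by linarith))
    · obtain ⟨d, rfl⟩ := Nat.exists_eq_add_of_lt c
      rw [show ringIndex true k (k + d + 1) = 2 * d + 1 by
        simp only [ringIndex]; split_ifs <;> simp_all <;> omega]
      push_cast
      exact le_abs.2 (Or.inr (by linarith))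
  · refine ⟨false, fun j hj => ?_⟩
    rcases lt_or_gt_of_ne hj with c | c
    · obtain ⟨d, rfl⟩ := Nat.exists_eq_add_of_lt c
      rw [show ringIndex false (j + d + 1) j = 2 * d + 1 by
        simp only [ringIndex]; split_ifs <;> simp_all <;> omega]
      push_cast
      exact le_abs.2 (Or.inl (by linarith))
    · obtain ⟨d, rfl⟩ := Nat.exists_eq_add_of_lt c
      rw [show ringIndex false k (k + d + 1) = 2 * d + 2 by
        simp only [ringIndex]; split_ifs <;> simp_all <;> omega]
      push_cast
      exact le_abs.2 (Or.inr (by linarith))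

/-- For a fixed half, blocks on the same side as the point have odd ring indices and those on the
other side even ones, so the ring index is injective and the sum is part of a single series over `e
≥ 1`. -/
theorem sum_ringIndex_le {N : ℕ} (b : Bool) (k : Fin N) {F : ℕ → ℝ} {B : ℝ}
    (hF : ∀ e, 0 ≤ F (e + 1)) (hB : ∀ M, ∑ e ∈ Finset.range M, F (e + 1) ≤ B) :
    ∑ j ∈ Finset.univ.erase k, F (ringIndex b k j) ≤ B := by
  have hpos : ∀ j : Fin N, j ≠ k → 1 ≤ ringIndex b k j := by
    intro j hj
    have : (j : ℕ) ≠ k := fun h => hj (Fin.ext h)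
    cases b <;> simp [ringIndex] <;> split_ifs <;> omega
  have hinj : Set.InjOn (fun j : Fin N => ringIndex b k j - 1)
      ((Finset.univ.erase k : Finset (Fin N)) : Set (Fin N)) := by
    intro i hi j hj h
    have hi' : (i : ℕ) ≠ k := fun h => (Finset.ne_of_mem_erase hi) (Fin.ext h)
    have hj' : (j : ℕ) ≠ k := fun h => (Finset.ne_of_mem_erase hj) (Fin.ext h)
    apply Fin.ext
    revert h
    cases b <;> simp [ringIndex] <;> split_ifs <;> omega
  calc ∑ j ∈ Finset.univ.erase k, F (ringIndex b k j)
      = ∑ j ∈ Finset.univ.erase k, F (ringIndex b k j - 1 + 1) := by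
        refine Finset.sum_congr rfl fun j hj => ?_
        rw [Nat.sub_add_cancel (hpos j (Finset.ne_of_mem_erase hj))]
    _ = ∑ e ∈ (Finset.univ.erase k).image (fun j : Fin N => ringIndex b k j - 1), F (e + 1) := by
        rw [Finset.sum_image hinj]
    _ ≤ ∑ e ∈ Finset.range (2 * N), F (e + 1) := by
        refine Finset.sum_le_sum_of_subset_of_nonneg ?_ fun e _ _ => hF e
        intro e he
        obtain ⟨j, hj, rfl⟩ := Finset.mem_image.1 he
        have h1 := j.2
        have h2 := k.2
        have hj' : (j : ℕ) ≠ k := fun h => (Finset.ne_of_mem_erase hj) (Fin.ext h)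
        rw [Finset.mem_range]
        cases b <;> simp [ringIndex] <;> split_ifs <;> omega
    _ ≤ B := hB _

theorem block_effect_le {n : ℕ} (j : Fin (numBlocks n)) {K u : ℝ} {e : ℕ} (hK : 0 < K)
    (hu : 4 * K ≤ u) (hu' : u ≤ n - 4 * K) (he : 1 ≤ e)
    (hd : 2 * (e : ℝ) ≤ |u - (4 * (j : ℕ) + 5 / 2)|) :
    blockCubic n j (pt n u) ≠ 0 ∧
    (1 + blockRatio n j) * nodalLength n (4 * (j : ℕ) + 3) ^ 3 ≤
      effectBound K e * |blockCubic n j (pt n u)| := by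
  have he' : (1 : ℝ) ≤ e := by exact_mod_cast he
  obtain ⟨h1, h2⟩ := block_effect j hK hu hu' (by linarith)
  refine ⟨h1, h2.trans ?_⟩
  unfold effectBound
  set D := |u - (4 * (j : ℕ) + 5 / 2)|
  have h3 : 0 < (2 * (e : ℝ)) ^ 2 - 1 := by nlinarith
  have h4 : 0 < 2 * (e : ℝ) - 1 := by linarith
  gcongr

theorem abs_shift_le {s a t : ℝ} (ht : 0 ≤ t) (ha : 0 ≤ a) (hs : s ∈ Set.Icc (-t) t) :
    |shift s a| ≤ t * (1 + t) ^ 2 * (1 + a) := by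
  have h := abs_le.2 hs
  unfold shift
  rw [abs_mul, abs_mul]
  have h1 : |1 + s| ≤ 1 + t := (abs_add_le _ _).trans (by rw [abs_one]; linarith)
  have h2 : |1 + a + s| ≤ (1 + t) * (1 + a) := (abs_add_le _ _).trans (by
    rw [abs_of_nonneg (by linarith : 0 ≤ 1 + a)]; nlinarith)
  calc |s| * |1 + s| * |1 + a + s| ≤ t * (1 + t) * ((1 + t) * (1 + a)) := by gcongr
    _ = _ := by ring

theorem deltaDisc_nonneg {s a t : ℝ} (ht : t ≤ 1 / 100) (ha : a ∈ Set.Icc (1 / 2 : ℝ) 2)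
    (hs : s ∈ Set.Icc (-t) t) : 0 ≤ deltaDisc s a := by
  have h1 := hs.1
  have h2 := hs.2
  have h3 := ha.1
  unfold deltaDisc
  nlinarith

/-- The product differs from `1` by at most `exp (∑ |f i|) - 1`, so only the sum of the relative
effects matters, not the number of blocks. -/
theorem abs_prod_sub_one_le {ι : Type*} (S : Finset ι) (f : ι → ℝ) {σ : ℝ} (hσ : σ ≤ 1)
    (h : ∑ i ∈ S, |f i| ≤ σ) : |∏ i ∈ S, (1 + f i) - 1| ≤ σ + σ ^ 2 := by
  have h1 := S.norm_prod_one_add_sub_one_le f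
  simp only [norm_eq_abs] at h1
  have h0 : 0 ≤ ∑ i ∈ S, |f i| := Finset.sum_nonneg fun i _ => abs_nonneg _
  have h2 := exp_le_exp.2 h
  have h3 := (abs_le.1 (abs_exp_sub_one_sub_id_le (x := σ) (by
    rw [abs_of_nonneg (by linarith)]; exact hσ))).2
  linarith

/-! ### Comparison of the two maps and surjectivity in one coordinate -/

/-- At a generic point of a central block the other blocks change the perturbed polynomial by less
than half of the size of the perturbation. -/
theorem abs_perturbedT_sub_le {n : ℕ} (hn : n % 4 = 1) (k : Fin (numBlocks n)) {K t w : ℝ}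
    (hK : 10 ^ 6 ≤ K) (hk : K ≤ (k : ℕ)) (hk' : 4 * ((k : ℕ) : ℝ) + 5 + 4 * K ≤ n) (ht : 0 < t)
    (ht' : t ≤ 1 / 10 ^ 7) {y : Fin (numBlocks n) → ℝ} (hy : ∀ i, y i ∈ Set.Icc (-t) t)
    (hw : |w| ≤ 2) (h0 : w ≠ -1) (h1 : w ≠ 0) (h2 : w ≠ 1) :
    |perturbedT n (Pi.single k (y k)) (pt n (4 * (k : ℕ) + 5 / 2 + w)) -
      perturbedT n y (pt n (4 * (k : ℕ) + 5 / 2 + w))| ≤ t / 2 := by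
  have hK0 : 0 < K := by linarith
  have hw' := abs_le.1 hw
  have hdisc : ∀ i, 0 ≤ deltaDisc (y i) (blockRatio n i) := fun i =>
    deltaDisc_nonneg (by linarith) (blockRatio_mem i) (hy i)
  obtain ⟨b, hb⟩ := exists_ringIndex (k : ℕ) hw
  have heff : ∀ j : Fin (numBlocks n), j ≠ k → _ := fun j hj =>
    block_effect_le (e := ringIndex b k j) j hK0 (u := 4 * (k : ℕ) + 5 / 2 + w) (by linarith)
      (by linarith) (by
        have : (j : ℕ) ≠ k := fun h => hj (Fin.ext h)
        cases b <;> simp [ringIndex] <;> split_ifs <;> omega)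
      (hb j fun h => hj (Fin.ext h))
  set P := pt n (4 * (k : ℕ) + 5 / 2 + w) with hP
  rw [perturbedT_eq_mul_prod k hdisc fun j hj => (heff j hj).1]
  have hsum : ∑ i ∈ Finset.univ.erase k, |-(shift (y i) (blockRatio n i) *
      nodalLength n (4 * (i : ℕ) + 3) ^ 3 / blockCubic n i P)| ≤ 41 / 100 * t := by
    have hterm : ∀ i ∈ Finset.univ.erase k, |-(shift (y i) (blockRatio n i) *
        nodalLength n (4 * (i : ℕ) + 3) ^ 3 / blockCubic n i P)| ≤
        t * (1 + t) ^ 2 * effectBound K (ringIndex b k i) := by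
      intro i hi
      obtain ⟨g1, g2⟩ := heff i (Finset.ne_of_mem_erase hi)
      have hL := centerLength_pos i
      rw [abs_neg, abs_div, abs_mul, abs_of_pos (pow_pos hL 3), div_le_iff₀ (abs_pos.2 g1)]
      have ha := (blockRatio_mem i).1
      calc |shift (y i) (blockRatio n i)| * nodalLength n (4 * (i : ℕ) + 3) ^ 3
          ≤ (t * (1 + t) ^ 2 * (1 + blockRatio n i)) * nodalLength n (4 * (i : ℕ) + 3) ^ 3 := by
            gcongr
            exact abs_shift_le ht.le (by linarith) (hy i)
        _ = t * (1 + t) ^ 2 * ((1 + blockRatio n i) * nodalLength n (4 * (i : ℕ) + 3) ^ 3) := by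
            ring
        _ ≤ t * (1 + t) ^ 2 * (effectBound K (ringIndex b k i) * |blockCubic n i P|) := by gcongr
        _ = _ := by ring
    refine (Finset.sum_le_sum hterm).trans ?_
    rw [← Finset.mul_sum]
    have hs := sum_ringIndex_le b k (effectBound_nonneg hK0) (sum_effectBound_le hK0)
    have hs' : 2 / 5 + 728 / K ≤ 401 / 1000 := by
      have : 728 / K ≤ 728 / 10 ^ 6 := by gcongr
      norm_num at this
      linarith
    calc t * (1 + t) ^ 2 * ∑ i ∈ Finset.univ.erase k, effectBound K (ringIndex b k i)
        ≤ t * (1 + t) ^ 2 * (401 / 1000) := by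
          gcongr
          linarith
      _ ≤ t * (1 + 1 / 10 ^ 7) ^ 2 * (401 / 1000) := by gcongr
      _ ≤ 41 / 100 * t := by
          norm_num
          linarith
  have hprod := abs_prod_sub_one_le _ _ (by linarith) hsum
  set Q := ∏ i ∈ Finset.univ.erase k, (1 + -(shift (y i) (blockRatio n i) *
    nodalLength n (4 * (i : ℕ) + 3) ^ 3 / blockCubic n i P))
  have hT : |perturbedT n (Pi.single k (y k)) P| ≤ 101 / 100 := by
    rw [perturbedT_single_eq k (hdisc k), hP, cofactor_mul_blockCubic hn]
    have g1 := abs_cos_le_one (π * (4 * (k : ℕ) + 5 / 2 + w))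
    have g2 := abs_sensitivity_le hn k hw h0 h1 h2
    have ha := blockRatio_mem k
    have g3 := abs_shift_le ht.le (by linarith [ha.1]) (hy k) (a := blockRatio n k)
    have g4 : |shift (y k) (blockRatio n k)| ≤ 1 / 10 ^ 6 := by
      refine g3.trans ?_
      calc t * (1 + t) ^ 2 * (1 + blockRatio n k)
          ≤ 1 / 10 ^ 7 * (1 + 1 / 10 ^ 7) ^ 2 * (1 + 2) := by
            have := ha.1
            gcongr
            exact ha.2
        _ ≤ 1 / 10 ^ 6 := by norm_num
    refine (abs_add_le _ _).trans ?_
    rw [abs_neg, abs_mul]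
    have g5 : |shift (y k) (blockRatio n k)| *
        |sensitivity n k (pt n (4 * (k : ℕ) + 5 / 2 + w))| ≤ 1 / 10 ^ 6 * 9200 := by gcongr
    norm_num at g5
    linarith
  rw [← mul_one_sub, abs_mul, abs_sub_comm]
  calc |perturbedT n (Pi.single k (y k)) P| * |Q - 1|
      ≤ 101 / 100 * (41 / 100 * t + (41 / 100 * t) ^ 2) := by gcongr
    -- Here `1.01 * 0.41 < 1/2`, and the quadratic term is negligible since `t ≤ 1 / 10 ^ 7`.
    _ ≤ t / 2 := by nlinarith

theorem abs_blockAverage_sub_le {n : ℕ} (hn : n % 4 = 1) (k : Fin (numBlocks n)) {K t : ℝ}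
    (hK : 10 ^ 6 ≤ K) (hk : K ≤ (k : ℕ)) (hk' : 4 * ((k : ℕ) : ℝ) + 5 + 4 * K ≤ n) (ht : 0 < t)
    (ht' : t ≤ 1 / 10 ^ 7) {y : Fin (numBlocks n) → ℝ} (hy : ∀ i, y i ∈ Set.Icc (-t) t) :
    |blockAverage n k (Pi.single k (y k)) - blockAverage n k y| ≤ t / 2 := by
  have hp := block_width_pos k
  unfold blockAverage
  rw [← mul_sub, ← intervalIntegral.integral_sub
    ((continuous_perturbedT n _).intervalIntegrable _ _)
    ((continuous_perturbedT n _).intervalIntegrable _ _), abs_mul, abs_of_pos (by positivity),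
    one_div, inv_mul_le_iff₀ hp]
  have := intervalIntegral.norm_integral_le_of_norm_le_const_ae (a := root n (4 * (k : ℕ) + 1))
    (b := root n (4 * (k : ℕ) + 5)) (C := t / 2)
    (f := fun x => perturbedT n (Pi.single k (y k)) x - perturbedT n y x) (by
      filter_upwards [ae_ne_interior_roots n k] with x hx hmem
      rw [Set.uIoc_of_le (by linarith), root_left_end, root_right_end] at hmem
      obtain ⟨w, h1, h2, h3, h4, h5, rfl⟩ :=
        exists_offset (by norm_num) (Set.Ioc_subset_Icc_self hmem) hx
      exact abs_perturbedT_sub_le hn k hK hk hk' ht ht' hy (abs_le.2 ⟨h1, h2⟩) h3 h4 h5)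
  rw [abs_of_pos hp, norm_eq_abs] at this
  linarith

/-- The decoupled average takes all values in `[-t, t]`. -/
theorem exists_blockAverage_single_eq {n : ℕ} (hn : n % 4 = 1) (k : Fin (numBlocks n)) {K t : ℝ}
    (hK : 10 ^ 6 ≤ K) (hk : K ≤ (k : ℕ)) (hk' : 4 * ((k : ℕ) : ℝ) + 5 + 4 * K ≤ n)
    (ht : 10 / K ≤ t) (ht' : t ≤ 1 / 10 ^ 7) {z : ℝ} (hz : z ∈ Set.Icc (-t) t) :
    ∃ s ∈ Set.Icc (-t) t, blockAverage n k (Pi.single k s) = z := by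
  have hK0 : 0 < K := by linarith
  have ht0 : 0 < t := lt_of_lt_of_le (by positivity) ht
  have hoff := abs_le.1 (abs_offset_le hn k hK0 hk hk')
  have hgain := le_gain hn k (by linarith) hk hk'
  have ha := blockRatio_mem k
  have hoff' : 2 / K ≤ t / 5 := by
    have : 10 / K = 5 * (2 / K) := by ring
    linarith
  set a := blockRatio n k with ha'
  have hg0 : 0 ≤ gain n k := by
    have : 0 < 1 + a := by linarith [ha.1]
    exact (pos_of_mul_pos_right (by linarith) this.le).le
  have hcont : ContinuousOn (fun s => offset n k + shift s a * gain n k) (Set.Icc (-t) t) := by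
    unfold shift
    fun_prop
  -- The negative side is the tighter one, as `shift (-t) a` is smaller in absolute value than `t *
  -- (1 + a)`. Numerically `19/20 * 13/10 ≥ 1 + 1/5`, where `t / 5` bounds the offset.
  have hlow : offset n k + shift (-t) a * gain n k ≤ -t := by
    have : (t * (1 - t) ^ 2) * ((1 + a) * gain n k) ≤ -(shift (-t) a * gain n k) := by
      have e : -(shift (-t) a * gain n k) = (t * (1 - t)) * ((1 + a - t) * gain n k) := by
        unfold shift; ring
      rw [e, show t * (1 - t) ^ 2 * ((1 + a) * gain n k) =
        (t * (1 - t)) * ((1 - t) * (1 + a) * gain n k) by ring]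
      have : 0 ≤ 1 - t := by linarith
      gcongr
      nlinarith [ha.1]
    have h2 : t * (19 / 20) * (13 / 10) ≤ (t * (1 - t) ^ 2) * ((1 + a) * gain n k) := by
      gcongr
      nlinarith
    linarith
  have hhigh : t ≤ offset n k + shift t a * gain n k := by
    have h1 : t * ((1 + a) * gain n k) ≤ shift t a * gain n k := by
      unfold shift
      have h3 : t * (1 + a) ≤ t * (1 + t) * (1 + a + t) := by
        have := ha.1
        rw [mul_assoc]
        gcongr
        nlinarith
      rw [← mul_assoc]
      gcongr
    have h2 : t * (13 / 10) ≤ t * ((1 + a) * gain n k) := by gcongr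
    linarith
  obtain ⟨s, hs, hsz⟩ := intermediate_value_Icc (by linarith : -t ≤ t) hcont
    ⟨hlow.trans hz.1, hz.2.trans hhigh⟩
  refine ⟨s, hs, ?_⟩
  rw [blockAverage_single k (deltaDisc_nonneg (by linarith) (blockRatio_mem k) hs)]
  exact hsz

end ChebPerturb


theorem mainTheorem4 :
    ∃ t : ℝ, 0 < t ∧ ∃ n₀ K₀ : ℕ, ∀ n K : ℕ, n₀ ≤ n → K₀ ≤ K → (∃ m : ℕ, n = 8 * m + 1) →
      (∀ (i : Fin (ChebPerturb.numBlocks n)) (s : ℝ), s ∈ Set.Icc (-t) t →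
        0 ≤ ChebPerturb.deltaDisc s (ChebPerturb.blockRatio n i)) ∧
      ChebPerturb.cube (ChebPerturb.numBlocks n) t ⊆
        ChebPerturb.decoupled n K '' ChebPerturb.cube (ChebPerturb.numBlocks n) t ∧
      ∀ i : Fin (ChebPerturb.numBlocks n),
        ∀ y ∈ ChebPerturb.cube (ChebPerturb.numBlocks n) t,
          |ChebPerturb.decoupled n K y i - ChebPerturb.coupled n K y i| ≤ t / 2 := by
  -- `K₀` is taken so large that `10 / K ≤ t`, which makes the offset at most `t / 5`. No lower
  -- bound on `n` is needed: a central block forces `n` to be large compared with `K`, and without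
  -- one both maps are the identity.
  refine ⟨1 / 10 ^ 7, by positivity, 0, 10 ^ 9, ?_⟩
  rintro n K - hK ⟨m, hm⟩
  have hn : n % 4 = 1 := by omega
  have hK9 : (10 : ℝ) ^ 9 ≤ K := by exact_mod_cast hK
  have hK6 : (10 : ℝ) ^ 6 ≤ K := le_trans (by norm_num) hK9
  have central : ∀ i : Fin (ChebPerturb.numBlocks n), ChebPerturb.IsCentral n K i →
      (K : ℝ) ≤ (i : ℕ) ∧ 4 * ((i : ℕ) : ℝ) + 5 + 4 * K ≤ n := by
    intro i ⟨h1, h2⟩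
    unfold ChebPerturb.numBlocks at h2
    constructor
    · exact_mod_cast Nat.lt_succ_iff.1 h1
    · have : 4 * (i : ℕ) + 5 + 4 * K ≤ n := by omega
      exact_mod_cast this
  refine ⟨fun i s hs => ChebPerturb.deltaDisc_nonneg (by norm_num) (ChebPerturb.blockRatio_mem i) hs,
    ?_, ?_⟩
  · intro z hz
    have hex : ∀ i, ∃ s ∈ Set.Icc (-(1 / 10 ^ 7) : ℝ) (1 / 10 ^ 7),
        (ChebPerturb.IsCentral n K i → ChebPerturb.blockAverage n i (Pi.single i s) = z i) ∧
        (¬ ChebPerturb.IsCentral n K i → s = z i) := by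
      intro i
      by_cases hc : ChebPerturb.IsCentral n K i
      · obtain ⟨s, hs, h⟩ := ChebPerturb.exists_blockAverage_single_eq hn i hK6 (central i hc).1
          (central i hc).2 (t := 1 / 10 ^ 7)
          (by rw [div_le_div_iff₀ (by linarith) (by norm_num)]; linarith) le_rfl (hz i)
        exact ⟨s, hs, fun _ => h, fun h' => absurd hc h'⟩
      · exact ⟨z i, hz i, fun h => absurd h hc, fun _ => rfl⟩
    choose y hy h1 h2 using hex
    refine ⟨y, hy, funext fun i => ?_⟩
    unfold ChebPerturb.decoupled
    split_ifs with hc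
    · exact h1 i hc
    · exact h2 i hc
  · intro i y hy
    unfold ChebPerturb.decoupled ChebPerturb.coupled
    split_ifs with hc
    · exact ChebPerturb.abs_blockAverage_sub_le hn i hK6 (central i hc).1 (central i hc).2
        (by positivity) le_rfl hy
    · rw [sub_self, abs_zero]; positivity
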